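/- A \emph{virtual link diagram} $D$ is a finite ribbon graph (combinatorial map) with oriented edges, all of whose vertices have degree $2$ (subdivision points) or $4$ (crossings), with a marked pair of opposite half-edges (the overstrand) at each crossing, and such that the orientations of opposite edges at each vertex are compatible. Gluing disks to the boundary components of the ribbon graph gives the closed oriented surface $\Sigma$ in which $D$ is \emph{cellularly embedded}. Let $c(D)$ be the number of crossings. $D$ is \emph{connected} if $\Sigma$ is nonempty and connected, and then $g(D)$ denotes the genus of $\Sigma$; $D$ is \emph{alternating} if passages through crossings along each link component are alternatingly over and under. Let $G$ be an abelian group, let $L$ be the framed oriented virtual link given by $D$ (blackboard framing), with components $L_1,\dots,L_n$, and let $\lambda_1,\dots,\lambda_n\in G$ be labels of the components. With algebraic intersection numbers in $\Sigma$, define $$h\colon H_1(\Sigma;\mathbb Z)\to G,\qquad h(\alpha)=\sum_{j=1}^n([L_j]\cdot\alpha)\,\lambda_j .$$ The $G$-labeled diagram $D$ is \emph{$h$-reduced} if $h([C])\neq 0$ for every simple closed curve $C\subset\Sigma$ that intersects the diagram through a single crossing (that is, $C$ meets $D$ only in this crossing and passes there from one corner to the opposite one). Let $R_G=\mathbb Z[A^{\pm1}][X_{\pm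 g}\mid g\in G]/(X_0-1)$, with one variable for each element of $G$ up to sign. For a Kauffman state $S$ of $D$ let $a(S)$ and $b(S)$ be the numbers of $A$- and $B$-smoothings, $b_0(S)$ the number of state loops, and $i(S)$ the number of state loops $C$ with $h([C])=0$. The homological arrow polynomial of $L$ is $$\mathcal A(L)=\sum_S A^{a(S)-b(S)}(-A^2-A^{-2})^{b_0(S)}\prod_{C\in S}X_{\pm h([C])}\in R_G ,$$ and substituting $X_{\pm g}\mapsto(-A^2-A^{-2})^{-1}X_{\pm g}$ for all $g\ne0$ gives $$\mathcal A'(L)=\sum_S A^{a(S)-b(S)}(-A^2-A^{-2})^{i(S)}\prod_{C\in S}X_{\pm h([C])}\in R_G .$$ For nonzero $p\in R_G$ let $\operatorname{breadth}_A p$ be the maximal minus the minimal exponent of $A$ in the monomials of $p$. \textbf{Corollary.} Let $D$ be an $h$-reduced connected alternating $G$-labeled virtual link diagram of $L$. Then $\mathcal A'(L)\neq 0$ and $$\operatorname{breadth}_A(\mathcal A'(L))=4c(D)-4g(D)+4 .$$ -/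

import Mathlib

open scoped LaurentPolynomial

noncomputable section

/-!
# Virtual link diagrams

A virtual link diagram is an oriented ribbon graph (combinatorial map) all of whose vertices have
degree 2 (subdivision points of arcs) or 4 (crossings).  It is given by the set `H` of its
half-edges.  A half-edge `d` is also read as the directed edge (dart) that leaves the vertex of `d`
through `d`; its reverse is `edge d`.
-/

/-- A virtual link diagram with set of half-edges `H`. -/
structure VirtualLinkDiagram (H : Type*) where
  /-- the next half-edge, counterclockwise, at the same vertex -/
  rot : Equiv.Perm H
  /-- the other half of the same edge -/
  edge : Equiv.Perm H
  /-- `out d` : the orientation of the link points away from the vertex of `d` along `d` -/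
  out : H → Bool
  /-- at a crossing, `isOver d` : the half-edge `d` belongs to the overstrand
  (no meaning at vertices of degree 2) -/
  isOver : H → Bool
  rot_four : ∀ d, rot (rot (rot (rot d))) = d
  edge_edge : ∀ d, edge (edge d) = d
  out_edge : ∀ d, out (edge d) = !out d
  out_rot : ∀ d, rot (rot d) = d → out (rot d) = !out d
  out_rot_rot : ∀ d, rot (rot d) ≠ d → out (rot (rot d)) = !out d
  isOver_rot : ∀ d, rot (rot d) ≠ d → isOver (rot d) = !isOver d

namespace VirtualLinkDiagram

variable {H : Type*} (D : VirtualLinkDiagram H)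

/-! ## Vertices, crossings, faces, components -/

/-- `d` is a half-edge at a vertex of degree 4. -/
def AtCrossing (d : H) : Prop := D.rot (D.rot d) ≠ d

/-- No vertex has degree 1, so the vertices of `D` have degree 2 or 4. -/
theorem rot_ne (d : H) : D.rot d ≠ d := by
  intro h
  have h2 : D.rot (D.rot d) = d := by rw [h, h]
  have := D.out_rot d h2
  rw [h] at this
  cases hd : D.out d <;> simp [hd] at this

theorem edge_ne (d : H) : D.edge d ≠ d := by
  intro h
  have := D.out_edge d
  rw [h] at this
  cases hd : D.out d <;> simp [hd] at this

theorem atCrossing_rot {d : H} : D.AtCrossing (D.rot d) ↔ D.AtCrossing d := by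
  unfold AtCrossing
  exact not_congr D.rot.injective.eq_iff

open Classical in
/-- The half-edge opposite to `d` at its vertex. -/
def opp (d : H) : H := if D.AtCrossing d then D.rot (D.rot d) else D.rot d

/-- Vertices are the cycles of `rot`. -/
def Vertex : Type _ := Quotient (Equiv.Perm.SameCycle.setoid D.rot)

/-- The vertex at which the half-edge `d` sits. -/
def vertexOf (d : H) : D.Vertex := Quotient.mk _ d

/-- Crossings are the vertices of degree 4. -/
def Crossing : Type _ := {v : D.Vertex // ∃ d, D.AtCrossing d ∧ D.vertexOf d = v}

/-- Edges are the cycles of `edge`. -/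
def Edge : Type _ := Quotient (Equiv.Perm.SameCycle.setoid D.edge)

/-- The dart following `d` along the boundary of the region on the left of `d`. -/
def facePerm : Equiv.Perm H := D.rot⁻¹ * D.edge

/-- Faces (boundary components of the ribbon graph) are the cycles of `facePerm`.  Gluing a disk to
each of them gives the closed oriented surface in which `D` is cellularly embedded.  The face of `d`
lies on the left of the dart `d`, and contains the corner from `d` to `rot d` at the vertex
of `d`. -/
def Face : Type _ := Quotient (Equiv.Perm.SameCycle.setoid D.facePerm)

/-- The face on the left of the dart `d`. -/
def faceOf (d : H) : D.Face := Quotient.mk _ d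

/-- Link components: go along edges, and straight through vertices. -/
def Component : Type _ := Quotient (Relation.EqvGen.setoid fun x y => y = D.edge x ∨ y = D.opp x)

/-- The link component to which the half-edge `d` belongs. -/
def componentOf (d : H) : D.Component := Quotient.mk _ d

section Finite

variable [Finite H]

instance : Finite D.Vertex := Quotient.finite _
instance : Finite D.Crossing := Subtype.finite
instance : Finite D.Edge := Quotient.finite _
instance : Finite D.Face := Quotient.finite _
instance : Finite D.Component := Quotient.finite _
instance : Fintype D.Vertex := Fintype.ofFinite _
instance : Fintype D.Crossing := Fintype.ofFinite _
instance : Fintype D.Edge := Fintype.ofFinite _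
instance : Fintype D.Face := Fintype.ofFinite _
instance : Fintype D.Component := Fintype.ofFinite _

/-- The number of crossings `c(D)`. -/
def crossingNumber : ℕ := Fintype.card D.Crossing

/-- The Euler characteristic of the closed surface in which `D` is cellularly embedded. -/
def eulerChar : ℤ := Fintype.card D.Vertex - Fintype.card D.Edge + Fintype.card D.Face

/-- The genus `g(D)` of the closed surface in which `D` is cellularly embedded, for connected `D`:
the number `g` with `χ = 2 - 2 g` (the division is exact, see `two_mul_genus`). -/
def genus : ℤ := (2 - D.eulerChar) / 2

open Classical in
/-- The sign of a permutation through its number of cycles (fixed points included). -/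
theorem sign_eq_neg_one_pow {α : Type*} [Fintype α] (f : Equiv.Perm α)
    [Fintype (Quotient (Equiv.Perm.SameCycle.setoid f))] :
    (Equiv.Perm.sign f : ℤ) =
      (-1) ^ (Fintype.card α + Fintype.card (Quotient (Equiv.Perm.SameCycle.setoid f))) := by
  let s := Equiv.Perm.SameCycle.setoid f
  have hout : ∀ a : α, f.SameCycle (Quotient.out (Quotient.mk s a)) a := fun a =>
    Quotient.exact (s := s) (Quotient.out_eq _)
  have h1 : (Finset.univ.filter fun q : Quotient s => q.out ∈ f.support).card =
      f.cycleFactorsFinset.card := by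
    refine Finset.card_bij (fun q _ => f.cycleOf q.out) ?_ ?_ ?_
    · intro q hq
      exact Equiv.Perm.cycleOf_mem_cycleFactorsFinset_iff.2 (Finset.mem_filter.1 hq).2
    · intro q hq q' hq' h
      rw [← Quotient.out_eq q, ← Quotient.out_eq q']
      exact Quotient.sound (s := s)
        ((Equiv.Perm.sameCycle_iff_cycleOf_eq_of_mem_support (Finset.mem_filter.1 hq).2
          (Finset.mem_filter.1 hq').2).2 h)
    · intro c hc
      obtain ⟨a, ha⟩ := (Equiv.Perm.mem_cycleFactorsFinset_iff.1 hc).1.nonempty_support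
      have hac := Equiv.Perm.cycle_is_cycleOf ha hc
      have e : f.cycleOf (Quotient.mk s a).out = c := by rw [hac]; exact (hout a).cycleOf_eq
      refine ⟨Quotient.mk s a, ?_, e⟩
      rw [Finset.mem_filter]
      refine ⟨Finset.mem_univ _, ?_⟩
      rw [← Equiv.Perm.cycleOf_mem_cycleFactorsFinset_iff, e]
      exact hc
  have h2 : (Finset.univ.filter fun q : Quotient s => ¬ q.out ∈ f.support).card =
      (Finset.univ.filter fun a : α => ¬ a ∈ f.support).card := by
    refine Finset.card_bij (fun q _ => q.out) ?_ ?_ ?_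
    · intro q hq
      simpa using hq
    · intro q _ q' _ h
      exact Quotient.out_injective h
    · intro a ha
      have hfix : Function.IsFixedPt f a := by simpa [Function.IsFixedPt] using ha
      have e : (Quotient.mk s a).out = a := by
        obtain ⟨n, hn⟩ := (hout a).symm
        rw [← hn]
        exact Function.IsFixedPt.perm_zpow hfix n
      exact ⟨Quotient.mk s a, by simpa [e] using ha, e⟩
  have h3 := Finset.card_filter_add_card_filter_not (s := (Finset.univ : Finset (Quotient s)))
    (fun q => q.out ∈ f.support)
  have h4 := Finset.card_filter_add_card_filter_not (s := (Finset.univ : Finset α))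
    (fun a => a ∈ f.support)
  have h5 : (Finset.univ.filter fun a : α => a ∈ f.support) = f.support := by ext; simp
  rw [Finset.card_univ] at h3 h4
  rw [Equiv.Perm.sign_of_cycleType, Equiv.Perm.sum_cycleType, Equiv.Perm.cycleType_def,
    Multiset.card_map, ← h4, ← h3, h5, h1, h2]
  push_cast
  rw [show ∀ a b c : ℕ, a + c + (b + c) = a + b + 2 * c by intros; ring, pow_add _ (_ + _),
    pow_mul]
  simp

/-- The Euler characteristic is even. -/
theorem two_mul_genus : 2 * D.genus = 2 - D.eulerChar := by
  classical
  have : Fintype H := Fintype.ofFinite H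
  have hn : Even (Fintype.card H) := by
    have h := Finset.card_filter_add_card_filter_not (s := (Finset.univ : Finset H))
      (fun d => D.out d = true)
    have e : (Finset.univ.filter fun d => D.out d = true).card =
        (Finset.univ.filter fun d => ¬ D.out d = true).card := by
      refine Finset.card_bij' (fun d _ => D.edge d) (fun d _ => D.edge d) ?_ ?_ ?_ ?_
      · intro d hd; simpa [D.out_edge] using hd
      · intro d hd; simpa [D.out_edge] using hd
      · intro d _; exact D.edge_edge d
      · intro d _; exact D.edge_edge d
    rw [Finset.card_univ, ← e] at h
    exact ⟨_, h.symm⟩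
  have hs : (Equiv.Perm.sign D.facePerm : ℤ) =
      Equiv.Perm.sign D.rot * Equiv.Perm.sign D.edge := by
    simp [facePerm]
  have i1 : Fintype (Quotient (Equiv.Perm.SameCycle.setoid D.rot)) :=
    inferInstanceAs (Fintype D.Vertex)
  have i2 : Fintype (Quotient (Equiv.Perm.SameCycle.setoid D.edge)) :=
    inferInstanceAs (Fintype D.Edge)
  have i3 : Fintype (Quotient (Equiv.Perm.SameCycle.setoid D.facePerm)) :=
    inferInstanceAs (Fintype D.Face)
  rw [sign_eq_neg_one_pow, sign_eq_neg_one_pow, sign_eq_neg_one_pow] at hs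
  have c1 : @Fintype.card _ i1 = Fintype.card D.Vertex := Fintype.card_congr (Equiv.refl D.Vertex)
  have c2 : @Fintype.card _ i2 = Fintype.card D.Edge := Fintype.card_congr (Equiv.refl D.Edge)
  have c3 : @Fintype.card _ i3 = Fintype.card D.Face := Fintype.card_congr (Equiv.refl D.Face)
  rw [c1, c2, c3] at hs
  have he : Even (D.eulerChar) := by
    rw [pow_add, pow_add, pow_add, hn.neg_one_pow, one_mul, one_mul, one_mul, ← pow_add] at hs
    have : Even (Fintype.card D.Face) ↔
        Even (Fintype.card D.Vertex + Fintype.card D.Edge) := by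
      rcases Nat.even_or_odd (Fintype.card D.Face) with h | h <;>
      rcases Nat.even_or_odd (Fintype.card D.Vertex + Fintype.card D.Edge) with h' | h' <;>
        rw [h.neg_one_pow, h'.neg_one_pow] at hs
      · simp [h, h']
      · norm_num at hs
      · norm_num at hs
      · simp [Nat.not_even_iff_odd.2 h, Nat.not_even_iff_odd.2 h']
    simp only [eulerChar, Int.even_add, Int.even_sub, Int.even_coe_nat]
    rw [Nat.even_add] at this
    tauto
  obtain ⟨k, hk⟩ := he
  rw [genus, hk]
  omega

end Finite

/-- The ribbon graph (equivalently, the surface) is connected and nonempty. -/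
def IsConnected : Prop :=
  Nonempty H ∧ ∀ x y : H, Relation.EqvGen (fun x y => y = D.edge x ∨ y = D.rot x) x y

/-- `straight d` is the dart that follows `d` along the link. -/
def straight (d : H) : H := D.opp (D.edge d)

/-- Along each link component, passages through crossings are alternatingly over and under:
if one leaves a crossing by `d` and then passes through vertices of degree 2 only, until one
arrives at a crossing by the edge of `straight^[n] d`, then this second passage
is over if and only if the first one is under. -/
def IsAlternating : Prop :=
  ∀ (d : H) (n : ℕ), D.AtCrossing d →
    (∀ j, 1 ≤ j → j ≤ n → ¬ D.AtCrossing (D.straight^[j] d)) →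
    D.AtCrossing (D.edge (D.straight^[n] d)) →
    D.isOver (D.edge (D.straight^[n] d)) = !D.isOver d

theorem faceOf_facePerm (d : H) : D.faceOf (D.facePerm d) = D.faceOf d :=
  (Quotient.sound (s := Equiv.Perm.SameCycle.setoid _) ⟨1, by simp⟩).symm

theorem faceOf_edge_rot (d : H) : D.faceOf (D.edge (D.rot d)) = D.faceOf d := by
  rw [← D.faceOf_facePerm (D.edge (D.rot d))]
  simp [facePerm, D.edge_edge]

theorem vertexOf_rot (d : H) : D.vertexOf (D.rot d) = D.vertexOf d :=
  (Quotient.sound (s := Equiv.Perm.SameCycle.setoid _) ⟨1, by simp⟩).symm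

theorem opp_opp (d : H) : D.opp (D.opp d) = d := by
  by_cases h : D.AtCrossing d
  · have h' : D.AtCrossing (D.rot (D.rot d)) := D.atCrossing_rot.2 (D.atCrossing_rot.2 h)
    simp [opp, h, h', D.rot_four]
  · have h' : ¬ D.AtCrossing (D.rot d) := fun k => h (D.atCrossing_rot.1 k)
    simp only [opp, h, h', if_false]
    exact not_not.1 h

theorem out_opp (d : H) : D.out (D.opp d) = !D.out d := by
  by_cases h : D.AtCrossing d
  · simp only [opp, h, if_true]; exact D.out_rot_rot d h
  · simp only [opp, h, if_false]; exact D.out_rot d (not_not.1 h)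

theorem componentOf_edge (d : H) : D.componentOf (D.edge d) = D.componentOf d :=
  (Quotient.sound (s := Relation.EqvGen.setoid fun x y => y = D.edge x ∨ y = D.opp x)
    (Relation.EqvGen.rel _ _ (Or.inl rfl))).symm

theorem componentOf_opp (d : H) : D.componentOf (D.opp d) = D.componentOf d :=
  (Quotient.sound (s := Relation.EqvGen.setoid fun x y => y = D.edge x ∨ y = D.opp x)
    (Relation.EqvGen.rel _ _ (Or.inr rfl))).symm

theorem vertexOf_facePerm (d : H) : D.vertexOf (D.facePerm d) = D.vertexOf (D.edge d) := by
  rw [← D.vertexOf_rot (D.facePerm d)]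
  simp [facePerm]

/-! ## Cellular homology of the surface, and intersection numbers with the link

Cellular 1-chains are functions `x : H → ℤ` with `x (edge d) = - x d`; the value `x d` is the
coefficient of the edge of `d`, directed as the dart `d`. -/

open Classical in
/-- The 1-chain of one dart. -/
def dartChain (d : H) : H → ℤ := Pi.single d 1 - Pi.single (D.edge d) 1

theorem dartChain_edge (x d : H) : D.dartChain x (D.edge d) = - D.dartChain x d := by
  classical
  have h1 : (D.edge d = x) ↔ d = D.edge x :=
    ⟨fun h => by rw [← h, D.edge_edge], fun h => by rw [h, D.edge_edge]⟩
  have h2 : (D.edge d = D.edge x) ↔ d = x := D.edge.injective.eq_iff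
  simp only [dartChain, Pi.sub_apply, Pi.single_apply, h1, h2]
  ring

section Homology

variable [Fintype H]

open Classical in
/-- Cellular 1-cycles: at each vertex the total outflow is zero. -/
def cycles : AddSubgroup (H → ℤ) where
  carrier := {x | (∀ d, x (D.edge d) = - x d) ∧
    ∀ v : D.Vertex, ∑ d with D.vertexOf d = v, x d = 0}
  zero_mem' := by simp
  add_mem' := by
    rintro x y ⟨hx, hx'⟩ ⟨hy, hy'⟩
    refine ⟨fun d => ?_, fun v => ?_⟩
    · simp only [Pi.add_apply, hx, hy]; ring
    · simp only [Pi.add_apply, Finset.sum_add_distrib, hx', hy', add_zero]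
  neg_mem' := by
    rintro x ⟨hx, hx'⟩
    refine ⟨fun d => ?_, fun v => ?_⟩
    · simp only [Pi.neg_apply, hx]
    · simp only [Pi.neg_apply, Finset.sum_neg_distrib, hx', neg_zero]

/-- The boundary of a cellular 2-chain; each face is bounded by the darts that have it on
their left. -/
def boundary : (D.Face → ℤ) →+ (H → ℤ) where
  toFun g d := g (D.faceOf d) - g (D.faceOf (D.edge d))
  map_zero' := by ext; simp
  map_add' g g' := by ext; simp only [Pi.add_apply]; ring

/-- The homology group `H₁(Σ; ℤ)` of the surface in which `D` is cellularly embedded. -/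
abbrev H1 : Type _ := D.cycles ⧸ D.boundary.range.addSubgroupOf D.cycles

open Classical in
/-- The algebraic intersection number `[Lᵢ] · x` of the link component `i` with a 1-chain `x`.
Push `Lᵢ` slightly to its left.  It then meets the graph `D` transversally, once for each passage of
`Lᵢ` through a crossing: if the passage leaves the crossing by the half-edge `d`,
then the push-off crosses the half-edge `rot d` on its left, and a dart leaving
the crossing by `rot d` crosses it from right to left, which has sign `+1`. -/
def intersection (i : D.Component) : (H → ℤ) →+ ℤ where
  toFun x := ∑ d with D.AtCrossing d ∧ D.out d = true ∧ D.componentOf d = i, x (D.rot d)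
  map_zero' := by simp
  map_add' x y := by simp [Finset.sum_add_distrib]

/-- The intersection number with a boundary vanishes. -/
theorem intersection_boundary (i : D.Component) (g : D.Face → ℤ) :
    D.intersection i (D.boundary g) = 0 := by
  classical
  have key : ∀ d, D.faceOf (D.edge (D.opp d)) =
      if D.AtCrossing d then D.faceOf (D.rot d) else D.faceOf d := by
    intro d
    by_cases h : D.AtCrossing d
    · simp only [opp, h, if_true]; exact D.faceOf_edge_rot _
    · simp only [opp, h, if_false]; exact D.faceOf_edge_rot _
  have h1 : D.intersection i (D.boundary g) =
      ∑ d with D.out d = true ∧ D.componentOf d = i,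
        (g (D.faceOf (D.edge (D.opp d))) - g (D.faceOf d)) := by
    simp only [intersection, boundary, AddMonoidHom.coe_mk, ZeroHom.coe_mk, Finset.sum_filter]
    refine Finset.sum_congr rfl fun d _ => ?_
    rw [key, D.faceOf_edge_rot]
    by_cases h : D.AtCrossing d <;> simp [h]
  rw [h1, Finset.sum_sub_distrib, sub_eq_zero]
  refine Finset.sum_bij' (fun d _ => D.edge (D.opp d)) (fun d _ => D.opp (D.edge d)) ?_ ?_ ?_ ?_ ?_
  · intro d hd
    simpa [D.out_edge, D.out_opp, D.componentOf_edge, D.componentOf_opp] using hd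
  · intro d hd
    simpa [D.out_edge, D.out_opp, D.componentOf_edge, D.componentOf_opp] using hd
  · intro d _; simp [D.edge_edge, D.opp_opp]
  · intro d _; simp [D.edge_edge, D.opp_opp]
  · intro d _; rfl

variable {G : Type*} [AddCommGroup G]

/-- `x ↦ ∑ᵢ ([Lᵢ] · x) λᵢ` on 1-chains. -/
def labeledIntersection (lam : D.Component → G) : (H → ℤ) →+ G where
  toFun x := ∑ i, D.intersection i x • lam i
  map_zero' := by simp
  map_add' x y := by simp [add_smul, Finset.sum_add_distrib]

/-- The homomorphism `h_{L,λ} : H₁(Σ) → G`, `h(α) = ∑ᵢ ([Lᵢ] · α) λᵢ`. -/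
def hom (lam : D.Component → G) : D.H1 →+ G :=
  QuotientAddGroup.lift _ ((D.labeledIntersection lam).comp D.cycles.subtype) (by
    rintro ⟨x, hx⟩ hx'
    obtain ⟨g, rfl⟩ := AddSubgroup.mem_addSubgroupOf.1 hx'
    simp [labeledIntersection, D.intersection_boundary])

/-! ### Closed walks as homology classes -/

open Classical in
theorem sum_dartChain (x : H) (v : D.Vertex) :
    ∑ d with D.vertexOf d = v, D.dartChain x d =
      (if D.vertexOf x = v then 1 else 0) - (if D.vertexOf (D.edge x) = v then 1 else 0) := by
  simp only [dartChain, Pi.sub_apply, Finset.sum_sub_distrib, Pi.single_apply]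
  simp

/-- The walk along the boundary of the face of `d` that starts with the dart `d` and consists of `k`
darts, as a 1-chain. -/
def faceWalk (d : H) (k : ℕ) : H → ℤ :=
  ∑ j ∈ Finset.range k, D.dartChain ((D.facePerm ^ j) d)

theorem faceWalk_mem_cycles {d : H} {k : ℕ}
    (h : D.vertexOf ((D.facePerm ^ k) d) = D.vertexOf d) : D.faceWalk d k ∈ D.cycles := by
  classical
  refine ⟨fun e => ?_, fun v => ?_⟩
  · simp [faceWalk, Finset.sum_apply, D.dartChain_edge]
  · have hsucc : ∀ j : ℕ, D.vertexOf ((D.facePerm ^ (j + 1)) d) =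
        D.vertexOf (D.edge ((D.facePerm ^ j) d)) := by
      intro j
      rw [pow_succ', Equiv.Perm.mul_apply, D.vertexOf_facePerm]
    simp only [faceWalk, Finset.sum_apply]
    rw [Finset.sum_comm]
    simp only [D.sum_dartChain, ← hsucc]
    have := Finset.sum_range_sub'
      (fun j => if D.vertexOf ((D.facePerm ^ j) d) = v then (1 : ℤ) else 0) k
    rw [this, h]
    simp

theorem vertexOf_of_eq_rot_rot {d : H} {k : ℕ} (h : (D.facePerm ^ k) d = D.rot (D.rot d)) :
    D.vertexOf ((D.facePerm ^ k) d) = D.vertexOf d := by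
  rw [h, D.vertexOf_rot, D.vertexOf_rot]

/-- The class in `H₁(Σ)` of a simple closed curve meeting the diagram in a single crossing.
Such a curve passes through the crossing from one corner to the opposite one, so for some half-edge
`d` at the crossing the corners of `d` and of `rot (rot d)` belong to the same face, and the rest of
the curve is an arc in this open disk from one corner to the other.  It is homotopic to
the walk along the boundary of the face between these two corners. -/
def loopClass (d : H) (k : ℕ) (h : (D.facePerm ^ k) d = D.rot (D.rot d)) : D.H1 :=
  QuotientAddGroup.mk ⟨D.faceWalk d k, D.faceWalk_mem_cycles (D.vertexOf_of_eq_rot_rot h)⟩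

/-- `D` is `h`-reduced with respect to the labeling `lam`: each simple closed curve `C` that
intersects the diagram through a single crossing has `h([C]) ≠ 0`. -/
def IsHReduced (lam : D.Component → G) : Prop :=
  ∀ (d : H) (k : ℕ) (h : (D.facePerm ^ k) d = D.rot (D.rot d)),
    D.AtCrossing d → D.hom lam (D.loopClass d k h) ≠ 0

/-! ## States -/

/-- A Kauffman state chooses a smoothing for each crossing: `true` is the `A`-smoothing and
`false` the `B`-smoothing. -/
abbrev State : Type _ := D.Crossing → Bool

variable {D}

open Classical in
/-- The half-edge to which `d` is joined at its vertex in the state `S`.  The `A`-smoothing opens the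
two corners swept out when the overstrand turns counterclockwise, that is, the corners from
`d` to `rot d` with `d` over; so it joins each under half-edge `d` to `rot d`, and
each over half-edge `d` to `rot⁻¹ d`.  The `B`-smoothing does the opposite. -/
def State.join (S : D.State) (d : H) : H :=
  if h : D.AtCrossing d then
    if S ⟨D.vertexOf d, d, h, rfl⟩ = D.isOver d then D.rot⁻¹ d else D.rot d
  else D.rot d

theorem State.join_join (S : D.State) (d : H) : S.join (S.join d) = d := by
  by_cases h : D.AtCrossing d
  · have h1 : D.AtCrossing (D.rot d) := D.atCrossing_rot.2 h
    have h2 : D.AtCrossing (D.rot⁻¹ d) := D.atCrossing_rot.1 (by simpa using h)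
    have o1 := D.isOver_rot d h
    have o2 : D.isOver d = !D.isOver (D.rot⁻¹ d) := by
      have := D.isOver_rot (D.rot⁻¹ d) h2
      simpa using this
    have v1 : (⟨D.vertexOf (D.rot d), _, h1, rfl⟩ : D.Crossing) = ⟨D.vertexOf d, d, h, rfl⟩ :=
      Subtype.ext (D.vertexOf_rot d)
    have v2 : (⟨D.vertexOf (D.rot⁻¹ d), _, h2, rfl⟩ : D.Crossing) = ⟨D.vertexOf d, d, h, rfl⟩ :=
      Subtype.ext (by
        show D.vertexOf (D.rot⁻¹ d) = D.vertexOf d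
        rw [← D.vertexOf_rot (D.rot⁻¹ d)]; simp)
    by_cases hS : S ⟨D.vertexOf d, d, h, rfl⟩ = D.isOver d
    · have e : S.join d = D.rot⁻¹ d := by simp [State.join, h, hS]
      have hne : ¬ (S ⟨D.vertexOf (D.rot⁻¹ d), _, h2, rfl⟩ = D.isOver (D.rot⁻¹ d)) := by
        rw [v2, hS, o2]; simp
      rw [e, State.join, dif_pos h2, if_neg hne]; simp
    · have e : S.join d = D.rot d := by simp [State.join, h, hS]
      have hne : S ⟨D.vertexOf (D.rot d), _, h1, rfl⟩ = D.isOver (D.rot d) := by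
        rw [v1, o1]; revert hS
        cases S ⟨D.vertexOf d, d, h, rfl⟩ <;> cases D.isOver d <;> simp
      rw [e, State.join, dif_pos h1, if_pos hne]; simp
  · have h' : ¬ D.AtCrossing (D.rot d) := fun k => h (D.atCrossing_rot.1 k)
    simp only [State.join, h, h', dif_neg, not_false_iff]
    exact not_not.1 h

theorem State.vertexOf_join (S : D.State) (d : H) : D.vertexOf (S.join d) = D.vertexOf d := by
  have h2 : D.vertexOf (D.rot⁻¹ d) = D.vertexOf d := by
    rw [← D.vertexOf_rot (D.rot⁻¹ d)]; simp
  unfold State.join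
  split_ifs
  · exact h2
  · exact D.vertexOf_rot d
  · exact D.vertexOf_rot d

/-- The number `a(S)` of `A`-smoothings. -/
def State.a (S : D.State) : ℕ := Fintype.card {c : D.Crossing // S c = true}

/-- The number `b(S)` of `B`-smoothings. -/
def State.b (S : D.State) : ℕ := Fintype.card {c : D.Crossing // S c = false}

/-- The components `C ∈ S` of the state `S`: closed curves that run along edges and are
joined at the vertices by `S.join`. -/
def State.Loop (S : D.State) : Type _ :=
  Quotient (Relation.EqvGen.setoid fun x y => y = D.edge x ∨ y = S.join x)

instance (S : D.State) : Finite S.Loop := Quotient.finite _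
instance (S : D.State) : Fintype S.Loop := Fintype.ofFinite _

/-- The number `b₀(S)` of components of the state `S`. -/
def State.b0 (S : D.State) : ℕ := Fintype.card S.Loop

/-- The dart that follows the dart `d` along a state curve. -/
def State.next (S : D.State) : Equiv.Perm H where
  toFun d := S.join (D.edge d)
  invFun d := D.edge (S.join d)
  left_inv d := by simp [S.join_join, D.edge_edge]
  right_inv d := by simp [S.join_join, D.edge_edge]

open Classical in
/-- The 1-chain traversed by the state curve through the dart `d`, oriented by `d`. -/
def State.curve (S : D.State) (d : H) : H → ℤ :=
  ∑ x with S.next.SameCycle d x, D.dartChain x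

theorem State.curve_mem_cycles (S : D.State) (d : H) : S.curve d ∈ D.cycles := by
  classical
  refine ⟨fun e => ?_, fun v => ?_⟩
  · simp [State.curve, Finset.sum_apply, D.dartChain_edge]
  · have hnext : ∀ x, D.vertexOf (D.edge x) = D.vertexOf (S.next x) := fun x =>
      (S.vertexOf_join (D.edge x)).symm
    simp only [State.curve, Finset.sum_apply]
    rw [Finset.sum_comm]
    simp only [D.sum_dartChain, Finset.sum_sub_distrib, hnext]
    rw [sub_eq_zero]
    refine Finset.sum_bij' (fun x _ => S.next⁻¹ x) (fun x _ => S.next x) ?_ ?_ ?_ ?_ ?_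
    · intro x hx; simpa using hx
    · intro x hx; simpa using hx
    · intro x _; simp
    · intro x _; simp
    · intro x _; simp

/-- The class `[C] ∈ H₁(Σ)` of a component `C` of the state `S`, for an arbitrary orientation
of `C`. -/
def State.loopClass (S : D.State) (C : S.Loop) : D.H1 :=
  QuotientAddGroup.mk ⟨S.curve (Quotient.out C), S.curve_mem_cycles _⟩

/-- The number `i(S)` of components `C` of the state `S` with `h([C]) = 0`. -/
def State.i (S : D.State) (lam : D.Component → G) : ℕ :=
  Nat.card {C : S.Loop // D.hom lam (S.loopClass C) = 0}

end Homology

end VirtualLinkDiagram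

/-! ## The ring `R_G` and the homological arrow polynomial -/

/-- Elements of `G` up to sign. -/
def signSetoid (G : Type*) [AddCommGroup G] : Setoid G where
  r a b := a = b ∨ a = -b
  iseqv :=
    { refl := fun a => Or.inl rfl
      symm := by
        rintro a b (rfl | rfl)
        · exact Or.inl rfl
        · exact Or.inr (neg_neg b).symm
      trans := by
        rintro a b c (rfl | rfl) (rfl | rfl)
        · exact Or.inl rfl
        · exact Or.inr rfl
        · exact Or.inr rfl
        · exact Or.inl (neg_neg c) }

/-- The nonzero elements of `G` up to sign, `{±g | g ∈ G, g ≠ 0}`. -/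
def NonzeroUpToSign (G : Type*) [AddCommGroup G] : Type _ :=
  {x : Quotient (signSetoid G) // x ≠ Quotient.mk _ 0}

/-- The ring `R_G = ℤ[A^{±1}][X_{±g} | g ∈ G] / (X_0 - 1)`, where `A` is `LaurentPolynomial.T 1`.
The relation `X_0 = 1` is realised by omitting the variable `X_0`. -/
abbrev ArrowRing (G : Type*) [AddCommGroup G] : Type _ :=
  MvPolynomial (NonzeroUpToSign G) ℤ[T;T⁻¹]

namespace ArrowRing

variable {G : Type*} [AddCommGroup G]

open Classical in
/-- The element `X_{±g}` of `R_G`, with `X_0 = 1`. -/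
def x (g : G) : ArrowRing G :=
  if h : (Quotient.mk (signSetoid G) g) ≠ Quotient.mk _ 0 then MvPolynomial.X ⟨_, h⟩ else 1

/-- The power `A^k`, for an integer `k`. -/
def aPow (k : ℤ) : ArrowRing G := MvPolynomial.C (LaurentPolynomial.T k)

/-- `-A² - A⁻²`. -/
def delta : ArrowRing G := - aPow 2 - aPow (-2)

theorem x_of_eq_zero {g : G} (h : g = 0) : x g = 1 := by
  subst h; simp [x]

theorem x_of_ne_zero {g : G} (h : g ≠ 0) :
    ∃ y : NonzeroUpToSign G, x g = MvPolynomial.X y := by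
  have h' : Quotient.mk (signSetoid G) g ≠ Quotient.mk _ 0 := by
    intro e
    rcases Quotient.exact e with e | e
    · exact h e
    · exact h (by simpa using e)
  exact ⟨⟨_, h'⟩, by rw [x, dif_pos h']⟩

/-- The exponents of `A` that occur in the monomials of `p`. -/
def exponents (p : ArrowRing G) : Set ℤ := {k | ∃ m, (MvPolynomial.coeff m p).coeff k ≠ 0}

/-- The maximal degree in `A` of a nonzero `p`. -/
def maxDeg (p : ArrowRing G) : ℤ := sSup p.exponents

/-- The minimal degree in `A` of a nonzero `p`. -/
def minDeg (p : ArrowRing G) : ℤ := sInf p.exponents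

/-- The breadth in `A` of a nonzero `p`. -/
def breadth (p : ArrowRing G) : ℤ := p.maxDeg - p.minDeg

theorem exponents_finite (p : ArrowRing G) : p.exponents.Finite := by
  classical
  refine (p.support.biUnion fun m => (MvPolynomial.coeff m p).coeff.support).finite_toSet.subset ?_
  rintro k ⟨m, hm⟩
  simp only [Finset.coe_biUnion, Set.mem_iUnion, Finset.mem_coe]
  refine ⟨m, ?_, Finsupp.mem_support_iff.2 hm⟩
  rw [MvPolynomial.mem_support_iff]
  rintro h
  simp [h] at hm

theorem exponents_nonempty {p : ArrowRing G} (hp : p ≠ 0) : p.exponents.Nonempty := by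
  obtain ⟨m, hm⟩ := MvPolynomial.ne_zero_iff.1 hp
  by_contra h
  refine hm (LaurentPolynomial.ext fun k => ?_)
  by_contra hk
  exact h ⟨k, m, hk⟩

/-- The substitution `X_{±g} ↦ (-A² - A⁻²) X_{±g}` for all `g ≠ 0`. -/
def scale : ArrowRing G →ₐ[ℤ[T;T⁻¹]] ArrowRing G :=
  MvPolynomial.aeval fun y => delta * MvPolynomial.X y

theorem scale_monomial (m : NonzeroUpToSign G →₀ ℕ) (r : ℤ[T;T⁻¹]) :
    scale (MvPolynomial.monomial m r : ArrowRing G) =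
      MvPolynomial.monomial m (r * (-LaurentPolynomial.T 2 - LaurentPolynomial.T (-2)) ^ m.degree) := by
  have hd : (delta : ArrowRing G) =
      MvPolynomial.C (-LaurentPolynomial.T 2 - LaurentPolynomial.T (-2)) := by
    simp [delta, aPow]
  rw [scale, MvPolynomial.aeval_monomial, hd, MvPolynomial.monomial_eq, MvPolynomial.algebraMap_eq]
  simp only [Finsupp.prod, mul_pow, Finset.prod_mul_distrib, Finset.prod_pow_eq_pow_sum]
  rw [map_mul, map_pow, Finsupp.degree_apply]
  ring

theorem scale_injective : Function.Injective (scale : ArrowRing G → ArrowRing G) := by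
  classical
  have hne : (-LaurentPolynomial.T 2 - LaurentPolynomial.T (-2) : ℤ[T;T⁻¹]) ≠ 0 := by
    intro h
    have := congrArg (fun p : ℤ[T;T⁻¹] => p.coeff 2) h
    simp only [LaurentPolynomial.T, AddMonoidAlgebra.coeff_sub, AddMonoidAlgebra.coeff_neg,
      AddMonoidAlgebra.coeff_single, AddMonoidAlgebra.coeff_zero, Finsupp.sub_apply,
      Finsupp.neg_apply, Finsupp.single_apply, Finsupp.zero_apply] at this
    norm_num at this
  have hc : ∀ (p : ArrowRing G) m, MvPolynomial.coeff m (scale p) = MvPolynomial.coeff m p *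
      (-LaurentPolynomial.T 2 - LaurentPolynomial.T (-2)) ^ m.degree := by
    intro p m
    induction p using MvPolynomial.induction_on' with
    | monomial n r =>
      rw [scale_monomial, MvPolynomial.coeff_monomial, MvPolynomial.coeff_monomial]
      by_cases h : n = m
      · simp [h]
      · simp [h]
    | add p q hp hq => rw [map_add, MvPolynomial.coeff_add, MvPolynomial.coeff_add, hp, hq, add_mul]
  intro p q h
  ext1 m
  have := congrArg (MvPolynomial.coeff m) h
  rw [hc, hc] at this
  exact mul_right_cancel₀ (pow_ne_zero _ hne) this

end ArrowRing

namespace VirtualLinkDiagram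

open ArrowRing

variable {H : Type*} [Fintype H] (D : VirtualLinkDiagram H) {G : Type*} [AddCommGroup G]

open Classical in
/-- The homological arrow polynomial `𝒜(L)` of the labeled framed virtual link `L` with diagram
`D`. -/
def arrowPoly (lam : D.Component → G) : ArrowRing G :=
  ∑ S : D.State, aPow ((S.a : ℤ) - S.b) * delta ^ S.b0 * ∏ C, x (D.hom lam (S.loopClass C))

open Classical in
/-- The polynomial `𝒜'(L)`, which results from `𝒜(L)` by the substitution
`X_{±g} ↦ (-A² - A⁻²)⁻¹ X_{±g}` for all `g ≠ 0`: see `scale_arrowPoly'`. -/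
def arrowPoly' (lam : D.Component → G) : ArrowRing G :=
  ∑ S : D.State, aPow ((S.a : ℤ) - S.b) * delta ^ S.i lam * ∏ C, x (D.hom lam (S.loopClass C))

/-- The inverse substitution `X_{±g} ↦ (-A² - A⁻²) X_{±g}`, which is injective by `scale_injective`,
turns `𝒜'(L)` into `𝒜(L)`. -/
theorem scale_arrowPoly' (lam : D.Component → G) :
    scale (D.arrowPoly' lam) = D.arrowPoly lam := by
  classical
  unfold arrowPoly' arrowPoly
  rw [map_sum]
  refine Finset.sum_congr rfl fun S _ => ?_
  have hA : ∀ k : ℤ, scale (aPow k : ArrowRing G) = aPow k := fun k => by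
    simp [scale, aPow, MvPolynomial.algebraMap_eq]
  have hd : scale (delta : ArrowRing G) = delta := by simp [delta, hA]
  have hx : ∀ g : G, scale (x g) = (if g = 0 then 1 else delta) * x g := by
    intro g
    by_cases h : g = 0
    · rw [x_of_eq_zero h, if_pos h, map_one, one_mul]
    · obtain ⟨y, hy⟩ := x_of_ne_zero h
      simp [hy, scale, h]
  rw [map_mul, map_mul, map_pow, hA, hd, map_prod]
  simp only [hx, Finset.prod_mul_distrib]
  have hi : S.b0 = S.i lam +
      (Finset.univ.filter fun C : S.Loop => ¬ D.hom lam (S.loopClass C) = 0).card := by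
    rw [State.b0, State.i, Nat.card_eq_fintype_card, Fintype.card_subtype,
      Finset.card_filter_add_card_filter_not, Finset.card_univ]
  rw [Finset.prod_ite, Finset.prod_const_one, one_mul, Finset.prod_const, hi, pow_add]
  ring

end VirtualLinkDiagram

end

noncomputable section

set_option linter.unusedSectionVars false

/-! ## Potentials along a cycle of a permutation -/

namespace Equiv.Perm

/-! A state `S` contributes one monomial in the `X` times `A^(a-b) (-A^2-A^(-2))^i`, whose exponents
of `A` lie between `a - b - 2i` and `a - b + 2i`, both ends having coefficient `±1`. The claim is
that the all-`A` state alone reaches the global maximum and the all-`B` state alone the global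
minimum.

Replacing an `A`-smoothing by a `B`-smoothing lowers `a - b` by 2, so the upper end does not rise as
long as `i` grows by at most one (`State.IsSwitch.i_le`), and it strictly drops at the first
replacement, where `i` does not grow at all (`IsColouring.i_le_of_isSwitch`). Induction on the
number of replacements gives `IsColouring.i_lt`; the lower end is symmetric.

Both bounds rest on potentials. A loop has label `0` exactly when some function on its half-edges is
constant across joins and changes along each dart by the weight of the dart
(`State.hom_loopClass_eq_zero_iff`). If the two strands at a crossing lie on different null loops,
their potentials can be shifted to vanish at all four half-edges there; the union is then also a
potential for the other smoothing, so every loop through the crossing is null after the switch.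
Orientations of the loops play no role, so a switch that neither splits nor merges loops needs no
separate case.

For an alternating diagram the faces are two-coloured, and the loops of the two constant states are
the boundaries of the faces of one colour each. They are null-homologous, so both extreme states
have `X`-monomial `1`, and together they have as many loops as there are faces, namely `c + 2 - 2g`.
If the first replacement produced two null loops out of a single face boundary, the common potential
would give label `0` to the curve through this face and the crossing, against `h`-reducedness. The
breadth is therefore `2c + 2(c + 2 - 2g)`. -/

theorem sum_sameCycle_eq_sum_range {α M : Type*} [Fintype α] [AddCommMonoid M]
    (p : Equiv.Perm α) (w : α → M) (d : α) [DecidablePred fun x => p.SameCycle d x] :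
    ∑ x with p.SameCycle d x, w x =
      ∑ j ∈ Finset.range (Function.minimalPeriod p d), w (p^[j] d) := by
  have hpos : 0 < Function.minimalPeriod p d :=
    Function.minimalPeriod_pos_of_mem_periodicPts (p.injective.mem_periodicPts d)
  symm
  refine Finset.sum_bij (fun j _ => p^[j] d) ?_ ?_ ?_ (fun _ _ => rfl)
  · intro j _
    simp only [Finset.mem_filter, Finset.mem_univ, true_and]
    exact ⟨j, by simp [Equiv.Perm.iterate_eq_pow]⟩
  · intro i hi j hj h
    exact (Function.iterate_eq_iterate_iff_of_lt_minimalPeriod (Finset.mem_range.1 hi)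
      (Finset.mem_range.1 hj)).1 h
  · intro x hx
    obtain ⟨n, hn⟩ := (Finset.mem_filter.1 hx).2.exists_nat_pow_eq
    refine ⟨n % Function.minimalPeriod p d, Finset.mem_range.2 (Nat.mod_lt _ hpos), ?_⟩
    rw [Function.iterate_mod_minimalPeriod_eq, ← hn, Equiv.Perm.iterate_eq_pow]

/-- A function with total sum zero along a cycle has a potential there. -/
theorem exists_potential {α M : Type*} [Fintype α] [AddCommGroup M]
    (p : Equiv.Perm α) (w : α → M) (d : α) [DecidablePred fun x => p.SameCycle d x]
    (h : ∑ x with p.SameCycle d x, w x = 0) :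
    ∃ f : α → M, ∀ x, p.SameCycle d x → f (p x) = f x + w x := by
  classical
  rw [sum_sameCycle_eq_sum_range] at h
  have hpos : 0 < Function.minimalPeriod p d :=
    Function.minimalPeriod_pos_of_mem_periodicPts (p.injective.mem_periodicPts d)
  set N := Function.minimalPeriod p d
  -- Partial sums of the weights around the cycle. They are periodic because the total vanishes, so
  -- they descend to a function on the cycle.
  let g : ℕ → M := fun n => ∑ j ∈ Finset.range n, w (p^[j] d)
  have hper : Function.Periodic g N := by
    intro n
    show ∑ j ∈ Finset.range (n + N), w (p^[j] d) = ∑ j ∈ Finset.range n, w (p^[j] d)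
    rw [add_comm, Finset.sum_range_add, h, zero_add]
    refine Finset.sum_congr rfl fun j _ => ?_
    rw [add_comm, Function.iterate_add_apply, Function.iterate_minimalPeriod]
  have hg : ∀ m n, p^[m] d = p^[n] d → g m = g n := by
    intro m n hmn
    rw [← hper.map_mod_nat m, ← hper.map_mod_nat n]
    congr 1
    refine (Function.iterate_eq_iterate_iff_of_lt_minimalPeriod (f := p) (x := d)
      (Nat.mod_lt _ hpos) (Nat.mod_lt _ hpos)).1 ?_
    rw [Function.iterate_mod_minimalPeriod_eq, Function.iterate_mod_minimalPeriod_eq, hmn]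
  -- By `hg` the chosen exponent is irrelevant; the value `0` off the cycle is never used.
  let f : α → M := fun x => if hx : ∃ n : ℕ, p^[n] d = x then g hx.choose else 0
  have hf : ∀ n : ℕ, f (p^[n] d) = g n := by
    intro n
    have hx : ∃ m : ℕ, p^[m] d = p^[n] d := ⟨n, rfl⟩
    simp only [f, dif_pos hx]
    exact hg _ _ hx.choose_spec
  refine ⟨f, fun x hx => ?_⟩
  obtain ⟨n, hn⟩ := hx.exists_nat_pow_eq
  rw [← Equiv.Perm.iterate_eq_pow] at hn
  rw [← hn, ← Function.iterate_succ_apply' p, hf, hf]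
  exact Finset.sum_range_succ _ _

/-- The sum of the increments of a function along a cycle vanishes. -/
theorem sum_sameCycle_sub {α M : Type*} [Fintype α] [AddCommGroup M]
    (p : Equiv.Perm α) (f : α → M) (d : α) [DecidablePred fun x => p.SameCycle d x] :
    ∑ x with p.SameCycle d x, (f (p x) - f x) = 0 := by
  rw [Finset.sum_sub_distrib, sub_eq_zero]
  refine Finset.sum_bij' (fun x _ => p x) (fun x _ => p⁻¹ x) ?_ ?_ ?_ ?_ ?_
  · intro x hx; simpa using hx
  · intro x hx; simpa using hx
  · intro x _; simp
  · intro x _; simp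
  · intro x _; rfl

end Equiv.Perm

/-! ## State loops and their classes -/

namespace VirtualLinkDiagram

variable {H : Type*} [Fintype H] {D : VirtualLinkDiagram H} {G : Type*} [AddCommGroup G]

variable (D) in
/-- The value of the labeled intersection form on a dart. -/
def weight (lam : D.Component → G) (d : H) : G := D.labeledIntersection lam (D.dartChain d)

theorem weight_edge (lam : D.Component → G) (d : H) :
    D.weight lam (D.edge d) = - D.weight lam d := by
  rw [weight, weight, ← map_neg]
  congr 1
  simp [dartChain, D.edge_edge]

theorem hom_loopClass_eq_sum_weight (lam : D.Component → G) (d : H) (k : ℕ)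
    (h : (D.facePerm ^ k) d = D.rot (D.rot d)) :
    D.hom lam (D.loopClass d k h) = ∑ j ∈ Finset.range k, D.weight lam ((D.facePerm ^ j) d) := by
  show D.labeledIntersection lam (D.faceWalk d k) = _
  rw [faceWalk, map_sum]; rfl

theorem labeledIntersection_boundary (lam : D.Component → G) (g : D.Face → ℤ) :
    D.labeledIntersection lam (D.boundary g) = 0 := by
  simp [labeledIntersection, D.intersection_boundary]

namespace State

variable (S : D.State)

theorem join_eq_or (d : H) : S.join d = D.rot d ∨ S.join d = D.rot⁻¹ d := by
  unfold State.join
  split_ifs <;> simp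

theorem join_ne (d : H) : S.join d ≠ d := by
  rcases S.join_eq_or d with h | h <;> rw [h]
  · exact D.rot_ne d
  · intro e
    exact D.rot_ne d ((congrArg D.rot e).symm.trans (D.rot.apply_symm_apply d))

theorem next_apply (d : H) : S.next d = S.join (D.edge d) := rfl

theorem edge_next (d : H) : D.edge (S.next d) = S.next⁻¹ (D.edge d) := rfl

/-- `next` is the product of the involutions `edge` and `join`, so conjugation by `edge` inverts it:
reversing darts reverses the direction of travel. -/
theorem edge_next_zpow (n : ℤ) (d : H) :
    D.edge ((S.next ^ n) d) = (S.next ^ (-n)) (D.edge d) := by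
  have h : D.edge * S.next * D.edge⁻¹ = S.next⁻¹ := by
    ext x
    exact (S.edge_next (D.edge⁻¹ x)).trans (congrArg (S.next⁻¹ : Equiv.Perm H) (D.edge.apply_symm_apply x))
  have h2 : D.edge * S.next ^ n * D.edge⁻¹ = S.next ^ (-n) := by
    rw [← conj_zpow, h, inv_zpow, zpow_neg]
  rw [← h2]
  simp

theorem sameCycle_edge {x y : H} :
    S.next.SameCycle (D.edge x) (D.edge y) ↔ S.next.SameCycle x y := by
  have key : ∀ x y : H, S.next.SameCycle x y → S.next.SameCycle (D.edge x) (D.edge y) := by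
    rintro x y ⟨n, rfl⟩
    exact ⟨-n, (S.edge_next_zpow n x).symm⟩
  refine ⟨fun h => ?_, key x y⟩
  have := key _ _ h
  rwa [D.edge_edge, D.edge_edge] at this

/-- The two directions of a state loop are different. -/
theorem not_sameCycle_edge (d : H) : ¬ S.next.SameCycle d (D.edge d) := by
  rintro ⟨n, hn⟩
  -- A dart meeting its own reverse after `n` steps would force a reflection at the midpoint: an
  -- edge fixed by `edge` if `n` is even, a half-edge fixed by `join` if `n` is odd.
  rcases Int.even_or_odd' n with ⟨m, rfl | rfl⟩
  · apply D.edge_ne ((S.next ^ m) d)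
    rw [S.edge_next_zpow, ← hn, ← Equiv.Perm.mul_apply, ← zpow_add]
    congr 2; ring
  · apply S.join_ne (D.edge ((S.next ^ m) d))
    rw [← S.next_apply, S.edge_next_zpow, ← hn, ← Equiv.Perm.mul_apply, ← Equiv.Perm.mul_apply,
      ← zpow_add, ← zpow_one_add]
    congr 2; ring

/-- The state loop through a half-edge. -/
def loopOf (d : H) : S.Loop := Quotient.mk _ d

theorem loopOf_edge (d : H) : S.loopOf (D.edge d) = S.loopOf d :=
  (Quotient.sound (s := Relation.EqvGen.setoid fun x y => y = D.edge x ∨ y = S.join x)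
    (Relation.EqvGen.rel _ _ (Or.inl rfl))).symm

theorem loopOf_join (d : H) : S.loopOf (S.join d) = S.loopOf d :=
  (Quotient.sound (s := Relation.EqvGen.setoid fun x y => y = D.edge x ∨ y = S.join x)
    (Relation.EqvGen.rel _ _ (Or.inr rfl))).symm

theorem loopOf_out (C : S.Loop) : S.loopOf (Quotient.out C) = C := Quotient.out_eq C

/-- An equivalence relation on half-edges that respects edges and joins contains the relation of
lying on the same state loop. -/
theorem loopOf_induction {r : H → H → Prop} (hr : Equivalence r)
    (hedge : ∀ x, r x (D.edge x)) (hjoin : ∀ x, r x (S.join x)) {x y : H}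
    (h : S.loopOf x = S.loopOf y) : r x y := by
  replace h : Relation.EqvGen (fun x y => y = D.edge x ∨ y = S.join x) x y := Quotient.exact h
  induction h with
  | rel x y h =>
    rcases h with rfl | rfl
    · exact hedge x
    · exact hjoin x
  | refl x => exact hr.refl x
  | symm x y _ ih => exact hr.symm ih
  | trans x y z _ _ ih1 ih2 => exact hr.trans ih1 ih2

/-- A set closed under edges and joins is a union of state loops. -/
theorem mem_of_loopOf_eq {K : Set H} (hedge : ∀ x ∈ K, D.edge x ∈ K)
    (hjoin : ∀ x ∈ K, S.join x ∈ K) {x y : H} (h : S.loopOf x = S.loopOf y) (hx : x ∈ K) :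
    y ∈ K := by
  refine (S.loopOf_induction (r := fun x y => x ∈ K ↔ y ∈ K)
    ⟨fun _ => Iff.rfl, Iff.symm, Iff.trans⟩ (fun x => ⟨hedge x, fun h => ?_⟩)
    (fun x => ⟨hjoin x, fun h => ?_⟩) h).1 hx
  · have := hedge _ h; rwa [D.edge_edge] at this
  · have := hjoin _ h; rwa [S.join_join] at this

theorem loopOf_next (d : H) : S.loopOf (S.next d) = S.loopOf d := by
  rw [S.next_apply, S.loopOf_join, S.loopOf_edge]

theorem loopOf_eq_of_sameCycle {x y : H} (h : S.next.SameCycle x y) :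
    S.loopOf y = S.loopOf x := by
  obtain ⟨n, rfl⟩ := h.exists_nat_pow_eq
  induction n with
  | zero => rfl
  | succ n ih =>
    rw [pow_succ', Equiv.Perm.mul_apply, S.loopOf_next]
    exact ih ⟨n, by simp⟩

/-- The two directions of travel along a loop give two cycles of `next`, interchanged by `edge`;
their union is closed under both generating involutions. -/
theorem loopOf_eq_iff {x d : H} :
    S.loopOf d = S.loopOf x ↔ S.next.SameCycle d x ∨ S.next.SameCycle d (D.edge x) := by
  constructor
  · intro h
    refine S.mem_of_loopOf_eq (K := {x | S.next.SameCycle d x ∨ S.next.SameCycle d (D.edge x)})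
      ?_ ?_ h (Or.inl (Equiv.Perm.SameCycle.refl _ _))
    · rintro x (h | h)
      · right; rwa [D.edge_edge]
      · exact Or.inl h
    · rintro x (h | h)
      · right
        exact Equiv.Perm.sameCycle_symm_apply_right.2 h
      · left
        have := Equiv.Perm.sameCycle_apply_right.2 h
        rwa [S.next_apply, D.edge_edge] at this
  · rintro (h | h)
    · exact (S.loopOf_eq_of_sameCycle h).symm
    · rw [← S.loopOf_eq_of_sameCycle h, S.loopOf_edge]

/-! ### Potentials on state loops -/

/-- `f` is constant along the joins of `S` and increases by the weight along each dart in `B`. -/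
def IsPotentialOn (lam : D.Component → G) (f : H → G) (B : Set H) : Prop :=
  ∀ x ∈ B, f (S.join x) = f x ∧ f (D.edge x) = f x + D.weight lam x

theorem IsPotentialOn.mono {S : D.State} {lam : D.Component → G} {f : H → G} {B K : Set H}
    (h : S.IsPotentialOn lam f K) (hBK : B ⊆ K) : S.IsPotentialOn lam f B :=
  fun x hx => h x (hBK hx)

/-- The set of half-edges on a state loop. -/
def loopSet (C : S.Loop) : Set H := {x | S.loopOf x = C}

theorem mem_loopSet {C : S.Loop} {x : H} : x ∈ S.loopSet C ↔ S.loopOf x = C := Iff.rfl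

theorem loopSet_injective : Function.Injective S.loopSet := by
  intro C C' h
  have : Quotient.out C ∈ S.loopSet C' := by rw [← h]; exact S.loopOf_out C
  rw [← this]
  exact (S.loopOf_out C).symm

open Classical in
theorem hom_loopClass (lam : D.Component → G) (C : S.Loop) :
    D.hom lam (S.loopClass C) =
      ∑ x with S.next.SameCycle (Quotient.out C) x, D.weight lam x := by
  show D.labeledIntersection lam (S.curve (Quotient.out C)) = _
  rw [State.curve, map_sum]; rfl

/-- The class of a state loop has label `0` if and only if the loop carries a potential. -/
theorem hom_loopClass_eq_zero_iff (lam : D.Component → G) (C : S.Loop) :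
    D.hom lam (S.loopClass C) = 0 ↔ ∃ f, S.IsPotentialOn lam f (S.loopSet C) := by
  classical
  rw [hom_loopClass]
  set d := Quotient.out C with hd
  have hC : S.loopOf d = C := S.loopOf_out C
  constructor
  · intro h
    obtain ⟨f, hf⟩ := Equiv.Perm.exists_potential S.next (D.weight lam) d h
    -- `f` lives on the darts of one direction. A half-edge of the other direction is the head of
    -- such a dart, and receives the value at its tail plus the weight of the dart.
    let F : H → G := fun x => if S.next.SameCycle d x then f x
      else f (D.edge x) + D.weight lam (D.edge x)
    have hexcl : ∀ x, S.next.SameCycle d x → ¬ S.next.SameCycle d (D.edge x) := fun x h1 h2 =>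
      S.not_sameCycle_edge x (h1.symm.trans h2)
    have hF1 : ∀ x, S.next.SameCycle d x → F x = f x := fun x h => if_pos h
    have hF2 : ∀ x, S.next.SameCycle d (D.edge x) →
        F x = f (D.edge x) + D.weight lam (D.edge x) := fun x h => if_neg fun h' => hexcl x h' h
    refine ⟨F, fun x hx => ?_⟩
    rw [mem_loopSet, ← hC, eq_comm, loopOf_eq_iff] at hx
    rcases hx with hx | hx
    · have h1 : S.next.SameCycle d (D.edge (S.join x)) :=
        Equiv.Perm.sameCycle_symm_apply_right.2 hx
      have h2 : S.next (D.edge (S.join x)) = x := S.next.apply_symm_apply x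
      refine ⟨?_, ?_⟩
      · rw [hF2 _ h1, hF1 _ hx, ← hf _ h1, h2]
      · rw [hF2 _ (by rwa [D.edge_edge]), D.edge_edge, hF1 _ hx]
    · have h1 : S.next.SameCycle d (S.join x) := by
        have := Equiv.Perm.sameCycle_apply_right.2 hx
        rwa [S.next_apply, D.edge_edge] at this
      have h2 : S.next (D.edge x) = S.join x := by rw [S.next_apply, D.edge_edge]
      refine ⟨?_, ?_⟩
      · rw [hF1 _ h1, hF2 _ hx, ← hf _ hx, h2]
      · rw [hF1 _ hx, hF2 _ hx, weight_edge]; abel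
  · rintro ⟨f, hf⟩
    -- The weights along the loop are the increments of the potential, so their sum telescopes.
    rw [← Equiv.Perm.sum_sameCycle_sub S.next f d]
    refine Finset.sum_congr rfl fun x hx => ?_
    have hx' : S.loopOf x = C := by
      rw [S.loopOf_eq_of_sameCycle (Finset.mem_filter.1 hx).2, hC]
    rw [S.next_apply, (hf (D.edge x) ((S.loopOf_edge x).trans hx')).1, (hf x hx').2]
    abel

/-- The half-edge sets of the state loops with label `0`. -/
def nullLoops (lam : D.Component → G) : Set (Set H) :=
  {B | (∃ d, B = S.loopSet (S.loopOf d)) ∧ ∃ f, S.IsPotentialOn lam f B}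

/-- Loops of different states live in different quotient types. As subsets of `H` they can be
compared directly. -/
theorem i_eq_ncard_nullLoops (lam : D.Component → G) : S.i lam = (S.nullLoops lam).ncard := by
  have : S.nullLoops lam = S.loopSet '' {C | D.hom lam (S.loopClass C) = 0} := by
    ext B
    constructor
    · rintro ⟨⟨d, rfl⟩, h⟩
      exact ⟨_, (S.hom_loopClass_eq_zero_iff lam _).2 h, rfl⟩
    · rintro ⟨C, hC, rfl⟩
      exact ⟨⟨Quotient.out C, by rw [loopOf_out]⟩, (S.hom_loopClass_eq_zero_iff lam _).1 hC⟩
  rw [this, Set.ncard_image_of_injective _ S.loopSet_injective]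
  rfl

end State

end VirtualLinkDiagram

/-! ## Changing a smoothing -/

namespace VirtualLinkDiagram

variable {H : Type*} [Fintype H] {D : VirtualLinkDiagram H} {G : Type*} [AddCommGroup G]

theorem rot_inv_eq (d : H) : D.rot⁻¹ d = D.rot (D.rot (D.rot d)) := by
  rw [Equiv.Perm.inv_def, Equiv.symm_apply_eq, D.rot_four]

theorem eq_of_vertexOf_eq {x d : H} (h : D.vertexOf x = D.vertexOf d) :
    x = d ∨ x = D.rot d ∨ x = D.rot (D.rot d) ∨ x = D.rot (D.rot (D.rot d)) := by
  have h' : D.rot.SameCycle d x :=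
    (Quotient.exact (s := Equiv.Perm.SameCycle.setoid D.rot) h).symm
  obtain ⟨n, rfl⟩ := h'.exists_nat_pow_eq
  clear h h'
  induction n with
  | zero => exact Or.inl rfl
  | succ n ih =>
    rw [pow_succ', Equiv.Perm.mul_apply]
    rcases ih with ih | ih | ih | ih <;> rw [ih]
    · simp
    · simp
    · simp
    · simp [D.rot_four]

theorem atCrossing_of_vertexOf_eq {x d : H} (h : D.vertexOf x = D.vertexOf d)
    (hd : D.AtCrossing d) : D.AtCrossing x := by
  rcases eq_of_vertexOf_eq h with rfl | rfl | rfl | rfl <;> simpa only [D.atCrossing_rot]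

namespace State

theorem join_of_atCrossing (S : D.State) {d : H} (h : D.AtCrossing d) :
    S.join d = if S ⟨D.vertexOf d, d, h, rfl⟩ = D.isOver d then D.rot⁻¹ d else D.rot d := by
  unfold State.join
  rw [dif_pos h]

theorem join_of_not_atCrossing (S : D.State) {d : H} (h : ¬ D.AtCrossing d) :
    S.join d = D.rot d := by
  unfold State.join
  rw [dif_neg h]

/-- Opposite half-edges of a crossing are both over or both under, so either smoothing is invariant
under the half turn. -/
theorem join_rot_rot (S : D.State) (d : H) : S.join (D.rot (D.rot d)) = D.rot (D.rot (S.join d)) := by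
  by_cases h : D.AtCrossing d
  · have h1 := D.atCrossing_rot.2 h
    have h2 : D.AtCrossing (D.rot (D.rot d)) := D.atCrossing_rot.2 h1
    have hv : (⟨D.vertexOf (D.rot (D.rot d)), _, h2, rfl⟩ : D.Crossing) =
        ⟨D.vertexOf d, d, h, rfl⟩ :=
      Subtype.ext ((D.vertexOf_rot _).trans (D.vertexOf_rot d))
    rw [join_of_atCrossing S h, join_of_atCrossing S h2, hv, D.isOver_rot _ h1, D.isOver_rot _ h,
      Bool.not_not]
    split_ifs
    · rw [rot_inv_eq, rot_inv_eq]
    · rfl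
  · have h2 : ¬ D.AtCrossing (D.rot (D.rot d)) := by
      rwa [D.atCrossing_rot, D.atCrossing_rot]
    rw [join_of_not_atCrossing S h, join_of_not_atCrossing S h2]

/-- A smoothed crossing consists of two arcs, one ending at `d` and the other at the opposite
half-edge, so at most two loops pass through it. -/
theorem loopOf_of_vertexOf_eq (S : D.State) {x d : H} (h : D.vertexOf x = D.vertexOf d) :
    S.loopOf x = S.loopOf d ∨ S.loopOf x = S.loopOf (D.rot (D.rot d)) := by
  have e : S.loopOf (D.rot d) = S.loopOf d ∧
        S.loopOf (D.rot (D.rot (D.rot d))) = S.loopOf (D.rot (D.rot d)) ∨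
      S.loopOf (D.rot d) = S.loopOf (D.rot (D.rot d)) ∧
        S.loopOf (D.rot (D.rot (D.rot d))) = S.loopOf d := by
    rcases S.join_eq_or d with hj | hj
    · left
      refine ⟨by rw [← hj, S.loopOf_join], ?_⟩
      rw [← S.loopOf_join (D.rot (D.rot d)), join_rot_rot, hj]
    · right
      rw [rot_inv_eq] at hj
      refine ⟨?_, by rw [← hj, S.loopOf_join]⟩
      rw [← S.loopOf_join (D.rot (D.rot d)), join_rot_rot, hj, D.rot_four]
  rcases eq_of_vertexOf_eq h with rfl | rfl | rfl | rfl
  · exact Or.inl rfl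
  · rcases e with e | e
    · exact Or.inl e.1
    · exact Or.inr e.1
  · exact Or.inr rfl
  · rcases e with e | e
    · exact Or.inr e.2
    · exact Or.inl e.2

/-- The states `S` and `S'` differ precisely by the smoothing at the vertex of `d`, and `S` joins
`d` to `rot d`. -/
structure IsSwitch (S S' : D.State) (d : H) : Prop where
  atCrossing : D.AtCrossing d
  join_eq : S.join d = D.rot d
  join_eq' : S'.join d = D.rot⁻¹ d
  join_off : ∀ x, D.vertexOf x ≠ D.vertexOf d → S'.join x = S.join x

theorem exists_isSwitch {S S' : D.State} (v : D.Crossing) (hv : S' v ≠ S v)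
    (h : ∀ c, c ≠ v → S' c = S c) : ∃ d, S.IsSwitch S' d := by
  obtain ⟨w, d, hd, rfl⟩ := v
  have hoff : ∀ x, D.vertexOf x ≠ D.vertexOf d → S'.join x = S.join x := by
    intro x hx
    by_cases hc : D.AtCrossing x
    · have e : S' (⟨D.vertexOf x, x, hc, rfl⟩ : D.Crossing) = S ⟨D.vertexOf x, x, hc, rfl⟩ :=
        h _ fun e => hx (congrArg Subtype.val e)
      rw [join_of_atCrossing S hc, join_of_atCrossing S' hc]
      exact if_congr (by rw [e]) rfl rfl
    · rw [join_of_not_atCrossing S hc, join_of_not_atCrossing S' hc]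
  have hd' := D.atCrossing_rot.2 hd
  have hvr : (⟨D.vertexOf (D.rot d), _, hd', rfl⟩ : D.Crossing) = ⟨D.vertexOf d, d, hd, rfl⟩ :=
      Subtype.ext (D.vertexOf_rot d)
  -- A half-edge is joined to its successor exactly when its over/under value differs from the
  -- smoothing. These values alternate around the crossing, so either `d` or `rot d` qualifies.
  by_cases ho : S ⟨D.vertexOf d, d, hd, rfl⟩ = D.isOver d
  · refine ⟨D.rot d, hd', ?_, ?_, ?_⟩
    · rw [join_of_atCrossing S hd', hvr, D.isOver_rot d hd, ho, if_neg (by simp)]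
    · rw [join_of_atCrossing S' hd', hvr, D.isOver_rot d hd, if_pos]
      rw [← ho]; exact Bool.eq_not.2 hv
    · intro x hx
      rw [D.vertexOf_rot] at hx
      exact hoff x hx
  · refine ⟨d, hd, ?_, ?_, hoff⟩
    · rw [join_of_atCrossing S hd, if_neg ho]
    · rw [join_of_atCrossing S' hd, if_pos]
      rw [Bool.eq_not.2 hv, Bool.eq_not.2 ho, Bool.not_not]

/-! ### Null loops before and after the change of one smoothing -/

section Switch

variable {S S' : D.State} {d : H} (lam : D.Component → G)

/-- The half-edge sets of the loops with label `0` that avoid the vertex `v`. -/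
def nullLoopsOff (S : D.State) (v : D.Vertex) : Set (Set H) :=
  {B ∈ S.nullLoops lam | ∀ x ∈ B, D.vertexOf x ≠ v}

/-- The half-edge sets of the loops with label `0` through the vertex `v`. -/
def nullLoopsAt (S : D.State) (v : D.Vertex) : Set (Set H) :=
  {B ∈ S.nullLoops lam | ∃ x ∈ B, D.vertexOf x = v}

theorem ncard_nullLoops (S : D.State) (v : D.Vertex) :
    (S.nullLoops lam).ncard = (S.nullLoopsOff lam v).ncard + (S.nullLoopsAt lam v).ncard := by
  rw [← Set.ncard_union_eq _ (Set.toFinite _) (Set.toFinite _)]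
  · congr 1
    ext B
    simp only [nullLoopsOff, nullLoopsAt, Set.mem_union, Set.mem_ofPred_eq, ← and_or_left]
    refine ⟨fun h => ⟨h, ?_⟩, fun h => h.1⟩
    by_cases hB : ∃ x ∈ B, D.vertexOf x = v
    · exact Or.inr hB
    · exact Or.inl fun x hx hv => hB ⟨x, hx, hv⟩
  · rw [Set.disjoint_left]
    rintro B ⟨_, h⟩ ⟨_, x, hx, hv⟩
    exact h x hx hv

/-- A loop that avoids the vertex uses the same edges and joins in both states, so both its
half-edge set and its potential carry over. -/
theorem nullLoopsOff_subset {v : D.Vertex} (h : ∀ x, D.vertexOf x ≠ v → S'.join x = S.join x) :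
    S.nullLoopsOff lam v ⊆ S'.nullLoopsOff lam v := by
  rintro B ⟨⟨⟨d, rfl⟩, f, hf⟩, hB⟩
  have hj : ∀ x ∈ S.loopSet (S.loopOf d), S'.join x = S.join x := fun x hx => h x (hB x hx)
  have e : S.loopSet (S.loopOf d) = S'.loopSet (S'.loopOf d) := by
    ext y
    constructor
    · intro hy
      -- The joins are known to agree only on the `S`-loop of `d`, so the induction must carry
      -- membership in that loop as well.
      refine (S.mem_of_loopOf_eq
        (K := {y | S.loopOf y = S.loopOf d ∧ S'.loopOf y = S'.loopOf d}) (x := d)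
        ?_ ?_ hy.symm ⟨rfl, rfl⟩).2
      · rintro x ⟨h1, h2⟩
        exact ⟨(S.loopOf_edge x).trans h1, (S'.loopOf_edge x).trans h2⟩
      · rintro x ⟨h1, h2⟩
        refine ⟨(S.loopOf_join x).trans h1, ?_⟩
        rw [← hj x h1]
        exact (S'.loopOf_join x).trans h2
    · intro hy
      refine S'.mem_of_loopOf_eq (K := S.loopSet (S.loopOf d)) (x := d) ?_ ?_ hy.symm rfl
      · intro x hx
        exact (S.loopOf_edge x).trans hx
      · intro x hx
        rw [hj x hx]
        exact (S.loopOf_join x).trans hx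
  refine ⟨⟨⟨d, e⟩, f, fun x hx => ?_⟩, hB⟩
  rw [hj x hx]
  exact hf x hx

theorem IsSwitch.nullLoopsOff_eq (h : S.IsSwitch S' d) :
    S.nullLoopsOff lam (D.vertexOf d) = S'.nullLoopsOff lam (D.vertexOf d) :=
  (nullLoopsOff_subset lam h.join_off).antisymm
    (nullLoopsOff_subset lam fun x hx => (h.join_off x hx).symm)

theorem nullLoopsAt_subset (S : D.State) (d : H) : S.nullLoopsAt lam (D.vertexOf d) ⊆
    {S.loopSet (S.loopOf d), S.loopSet (S.loopOf (D.rot (D.rot d)))} := by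
  rintro B ⟨⟨⟨e, rfl⟩, _⟩, x, hx, hv⟩
  rw [mem_loopSet] at hx
  rw [← hx]
  rcases S.loopOf_of_vertexOf_eq hv with h | h <;> simp [h]

theorem loopSet_mem_nullLoopsAt {x : H} (hv : D.vertexOf x = D.vertexOf d) {f : H → G}
    (hf : S.IsPotentialOn lam f (S.loopSet (S.loopOf x))) :
    S.loopSet (S.loopOf x) ∈ S.nullLoopsAt lam (D.vertexOf d) :=
  ⟨⟨⟨x, rfl⟩, f, hf⟩, x, rfl, hv⟩

/-- Either at most one loop with label `0` passes through the crossing in the state `S'`, or the two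
strands at the crossing belong to different loops with label `0`. -/
theorem ncard_nullLoopsAt_le_one_or (S : D.State) (d : H) :
    (S.nullLoopsAt lam (D.vertexOf d)).ncard ≤ 1 ∨
      (S.nullLoopsAt lam (D.vertexOf d)).ncard = 2 ∧
      S.loopOf d ≠ S.loopOf (D.rot (D.rot d)) ∧
      (∃ f, S.IsPotentialOn lam f (S.loopSet (S.loopOf d))) ∧
      ∃ f, S.IsPotentialOn lam f (S.loopSet (S.loopOf (D.rot (D.rot d)))) := by
  by_cases h1 : (S.nullLoopsAt lam (D.vertexOf d)).ncard ≤ 1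
  · exact Or.inl h1
  right
  have hsub := nullLoopsAt_subset lam S d
  have h2 : ({S.loopSet (S.loopOf d), S.loopSet (S.loopOf (D.rot (D.rot d)))} :
      Set (Set H)).ncard ≤ 2 := (Set.ncard_insert_le _ _).trans (by simp)
  have heq := Set.eq_of_subset_of_ncard_le hsub (by omega) (Set.toFinite _)
  refine ⟨?_, ?_, ?_, ?_⟩
  · rw [← heq] at h2; omega
  · intro e
    apply h1
    rw [heq, e, Set.pair_eq_singleton, Set.ncard_singleton]
  · have : S.loopSet (S.loopOf d) ∈ S.nullLoopsAt lam (D.vertexOf d) := by rw [heq]; simp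
    exact this.1.2
  · have : S.loopSet (S.loopOf (D.rot (D.rot d))) ∈ S.nullLoopsAt lam (D.vertexOf d) := by
      rw [heq]; simp
    exact this.1.2

/-- If in the state `S'` the two strands at the crossing belong to different loops with label `0`,
then some function is a potential of both states on these loops. -/
theorem IsSwitch.exists_potential (h : S.IsSwitch S' d)
    (hne : S'.loopOf d ≠ S'.loopOf (D.rot (D.rot d)))
    (h1 : ∃ f, S'.IsPotentialOn lam f (S'.loopSet (S'.loopOf d)))
    (h2 : ∃ f, S'.IsPotentialOn lam f (S'.loopSet (S'.loopOf (D.rot (D.rot d))))) :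
    ∃ (f : H → G) (K : Set H), S.IsPotentialOn lam f K ∧ S'.IsPotentialOn lam f K ∧
      (∀ x ∈ K, D.edge x ∈ K) ∧ (∀ x ∈ K, S.join x ∈ K) ∧
      ∀ x, D.vertexOf x = D.vertexOf d → x ∈ K := by
  classical
  obtain ⟨f1, hf1⟩ := h1
  obtain ⟨f2, hf2⟩ := h2
  -- A potential on a loop may be shifted by a constant. Normalise each of the two to vanish at the
  -- crossing; the shifts are independent because the loops are different.
  let f : H → G := fun x => if S'.loopOf x = S'.loopOf d then f1 x - f1 d
    else f2 x - f2 (D.rot (D.rot d))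
  let K : Set H := {x | S'.loopOf x = S'.loopOf d ∨ S'.loopOf x = S'.loopOf (D.rot (D.rot d))}
  have hK : ∀ x, D.vertexOf x = D.vertexOf d → x ∈ K := fun x hx => S'.loopOf_of_vertexOf_eq hx
  have hfS' : S'.IsPotentialOn lam f K := by
    rintro x (hx | hx)
    · simp only [f, S'.loopOf_join, S'.loopOf_edge, hx, if_true]
      rw [(hf1 x hx).1, (hf1 x hx).2]
      exact ⟨rfl, by abel⟩
    · simp only [f, S'.loopOf_join, S'.loopOf_edge, hx, hne.symm, if_false]
      rw [(hf2 x hx).1, (hf2 x hx).2]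
      exact ⟨rfl, by abel⟩
  have hvv : D.vertexOf (D.rot (D.rot d)) = D.vertexOf d :=
    (D.vertexOf_rot _).trans (D.vertexOf_rot d)
  -- Each arc of `S'` at the crossing has an end where `f` is `0` by normalisation, and `f` is
  -- constant along the arc. Vanishing at all four half-edges makes `f` indifferent to how they are
  -- joined.
  have hf0 : ∀ x, D.vertexOf x = D.vertexOf d → f x = 0 := by
    have e1 : f d = 0 := by simp [f]
    have e2 : f (D.rot (D.rot d)) = 0 := by simp [f, hne.symm]
    have j1 : f (D.rot (D.rot (D.rot d))) = 0 := by
      rw [← rot_inv_eq, ← h.join_eq', (hfS' d (hK d rfl)).1, e1]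
    have j2 : f (D.rot d) = 0 := by
      have := (hfS' _ (hK _ hvv)).1
      rw [join_rot_rot, h.join_eq', rot_inv_eq, D.rot_four, e2] at this
      exact this
    intro x hx
    rcases eq_of_vertexOf_eq hx with rfl | rfl | rfl | rfl <;> assumption
  refine ⟨f, K, ?_, hfS', ?_, ?_, hK⟩
  · intro x hx
    refine ⟨?_, (hfS' x hx).2⟩
    by_cases hv : D.vertexOf x = D.vertexOf d
    · rw [hf0 x hv, hf0 _ ((S.vertexOf_join x).trans hv)]
    · rw [← h.join_off x hv, (hfS' x hx).1]
  · intro x hx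
    simpa only [K, Set.mem_ofPred_eq, S'.loopOf_edge] using hx
  · intro x hx
    by_cases hv : D.vertexOf x = D.vertexOf d
    · exact hK _ ((S.vertexOf_join x).trans hv)
    · rw [← h.join_off x hv]
      simpa only [K, Set.mem_ofPred_eq, S'.loopOf_join] using hx

theorem loopSet_subset {K : Set H} (hedge : ∀ x ∈ K, D.edge x ∈ K)
    (hjoin : ∀ x ∈ K, S.join x ∈ K) {x : H} (hx : x ∈ K) : S.loopSet (S.loopOf x) ⊆ K :=
  fun _ hy => S.mem_of_loopOf_eq hedge hjoin (mem_loopSet S |>.1 hy).symm hx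

/-- A change of one smoothing adds at most one loop with label `0`. -/
theorem IsSwitch.i_le (h : S.IsSwitch S' d) : S'.i lam ≤ S.i lam + 1 := by
  rw [i_eq_ncard_nullLoops, i_eq_ncard_nullLoops, ncard_nullLoops lam S (D.vertexOf d),
    ncard_nullLoops lam S' (D.vertexOf d), h.nullLoopsOff_eq lam]
  rcases ncard_nullLoopsAt_le_one_or lam S' d with h1 | ⟨h1, hne, p1, p2⟩
  · omega
  -- Two null loops of `S'` at the crossing force at least one of `S` there, so the gain is at most
  -- one.
  · obtain ⟨f, K, hf, -, hedge, hjoin, hK⟩ := h.exists_potential lam hne p1 p2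
    have hmem := loopSet_mem_nullLoopsAt (S := S) lam (d := d) rfl
      (hf.mono (loopSet_subset hedge hjoin (hK d rfl)))
    have := (Set.ncard_pos (Set.toFinite _)).2 ⟨_, hmem⟩
    omega

end Switch

end State

end VirtualLinkDiagram

/-! ## The checkerboard colouring of an alternating diagram -/

namespace VirtualLinkDiagram

variable {H : Type*} [Fintype H] {D : VirtualLinkDiagram H} {G : Type*} [AddCommGroup G]

variable (D) in
/-- A colouring of the half-edges that extends the over/under information at the crossings and
alternates along edges and around vertices; thus it is constant along the boundary of
each face. -/
structure IsColouring (o : H → Bool) : Prop where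
  edge : ∀ d, o (D.edge d) = !o d
  rot : ∀ d, o (D.rot d) = !o d
  isOver : ∀ d, D.AtCrossing d → o d = D.isOver d

variable (D) in
/-- The dart that precedes `d` along the link. -/
def previous (d : H) : H := D.edge (D.opp d)

theorem previous_edge (d : H) : D.previous (D.edge d) = D.edge (D.straight d) := rfl

theorem previous_straight (d : H) : D.previous (D.straight d) = d := by
  simp [previous, straight, D.opp_opp, D.edge_edge]

theorem straight_previous (d : H) : D.straight (D.previous d) = d := by
  simp [previous, straight, D.opp_opp, D.edge_edge]

theorem atCrossing_opp {d : H} : D.AtCrossing (D.opp d) ↔ D.AtCrossing d := by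
  unfold opp
  split_ifs <;> simp only [D.atCrossing_rot]

theorem previous_iterate_edge (n : ℕ) (d : H) :
    D.previous^[n] (D.edge d) = D.edge (D.straight^[n] d) := by
  induction n with
  | zero => rfl
  | succ n ih =>
    rw [Function.iterate_succ_apply', ih, Function.iterate_succ_apply', previous_edge]

theorem straight_iterate_previous_iterate (n : ℕ) (d : H) :
    D.straight^[n] (D.previous^[n] d) = d :=
  (Function.LeftInverse.iterate straight_previous n) d

variable (D) in
/-- Going back along the link from `d` one meets a crossing. -/
def ReachesCrossing (d : H) : Prop := ∃ n, D.AtCrossing (D.previous^[n] d)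

/-- `straight` permutes a finite set, so the crossing behind `d` is also met by going forward from
`d`, which is going backward from `edge d`. -/
theorem ReachesCrossing.edge {d : H} (h : D.ReachesCrossing d) : D.ReachesCrossing (D.edge d) := by
  obtain ⟨n, hn⟩ := h
  let p : Equiv.Perm H := ⟨D.straight, D.previous, previous_straight, straight_previous⟩
  have hs : p.SameCycle d (D.previous^[n] d) := by
    refine Equiv.Perm.SameCycle.symm ⟨n, ?_⟩
    rw [zpow_natCast, ← Equiv.Perm.iterate_eq_pow]
    exact straight_iterate_previous_iterate n d
  -- The exponent must be positive: the last application of `straight` ends with `opp`, which is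
  -- stripped off to reach the arriving half-edge.
  obtain ⟨m, hm0, -, hm⟩ := hs.exists_pow_eq''
  rw [← Equiv.Perm.iterate_eq_pow] at hm
  obtain ⟨m, rfl⟩ := Nat.exists_eq_succ_of_ne_zero hm0.ne'
  refine ⟨m, ?_⟩
  rw [previous_iterate_edge, ← atCrossing_opp]
  rw [← hm, Function.iterate_succ_apply'] at hn
  exact hn

theorem reachesCrossing_edge {d : H} : D.ReachesCrossing (D.edge d) ↔ D.ReachesCrossing d :=
  ⟨fun h => by simpa only [D.edge_edge] using h.edge, ReachesCrossing.edge⟩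

theorem reachesCrossing_previous {d : H} (hd : ¬ D.AtCrossing d) :
    D.ReachesCrossing (D.previous d) ↔ D.ReachesCrossing d := by
  constructor
  · rintro ⟨n, hn⟩
    exact ⟨n + 1, hn⟩
  · rintro ⟨_ | n, hn⟩
    · exact absurd hn hd
    · exact ⟨n, hn⟩

open Classical in
variable (D) in
/-- The half-edge `d` is coloured as the last crossing before `d` is passed; on components without
crossings the orientation is used. -/
def overColour (d : H) : Bool :=
  if h : D.ReachesCrossing d then D.isOver (D.previous^[Nat.find h] d) else D.out d

theorem overColour_of_atCrossing {d : H} (hd : D.AtCrossing d) : D.overColour d = D.isOver d := by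
  classical
  have h : D.ReachesCrossing d := ⟨0, hd⟩
  have h0 : Nat.find h = 0 := (Nat.find_eq_zero h).2 hd
  rw [overColour, dif_pos h, h0]; rfl

theorem overColour_previous {d : H} (hd : ¬ D.AtCrossing d) :
    D.overColour (D.previous d) = D.overColour d := by
  classical
  by_cases h : D.ReachesCrossing d
  · have h' := (reachesCrossing_previous hd).2 h
    have e : Nat.find h = Nat.find h' + 1 := Nat.find_comp_succ h h' hd
    rw [overColour, dif_pos h', overColour, dif_pos h, e, Function.iterate_succ_apply]
  · have h' := mt (reachesCrossing_previous hd).1 h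
    rw [overColour, dif_neg h', overColour, dif_neg h, previous, D.out_edge, D.out_opp,
      Bool.not_not]

/-- The colours of `d` and `edge d` come from the nearest crossings in the two directions along the
component. These are consecutive passages, one over and one under. -/
theorem IsAlternating.overColour_edge (halt : D.IsAlternating) (d : H) :
    D.overColour (D.edge d) = !D.overColour d := by
  classical
  by_cases h : D.ReachesCrossing d
  · have h' := h.edge
    rw [overColour, dif_pos h', overColour, dif_pos h, previous_iterate_edge]
    have hm := Nat.find_spec h'
    have hm' := fun k hk => Nat.find_min h' (m := k) hk
    have hn := Nat.find_spec h
    have hn' := fun k hk => Nat.find_min h (m := k) hk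
    generalize Nat.find h' = m at *
    generalize Nat.find h = n at *
    rw [previous_iterate_edge] at hm
    set e := D.previous^[n] d with he
    have hed : D.straight^[n] e = d := straight_iterate_previous_iterate n d
    have hadd : ∀ j, D.straight^[j + n] e = D.straight^[j] d := fun j => by
      rw [Function.iterate_add_apply, hed]
    have key := halt e (m + n) hn ?_ (by rwa [hadd])
    · rwa [hadd] at key
    · intro j hj1 hj2
      -- Up to `d` there is no crossing by minimality of `n`, beyond `d` none by minimality of `m`.
      rcases le_or_gt j n with hjn | hjn
      · obtain ⟨k, rfl⟩ := Nat.exists_eq_add_of_le hjn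
        have : D.straight^[j] e = D.previous^[k] d := by
          rw [he, Function.iterate_add_apply, straight_iterate_previous_iterate]
        rw [this]
        exact hn' k (by omega)
      · obtain ⟨k, rfl⟩ := Nat.exists_eq_add_of_lt hjn
        rw [show n + k + 1 = k + 1 + n by omega, hadd, Function.iterate_succ_apply', straight,
          atCrossing_opp, ← previous_iterate_edge]
        exact hm' k (by omega)
  · have h' := mt reachesCrossing_edge.1 h
    rw [overColour, dif_neg h', overColour, dif_neg h, D.out_edge]

theorem IsAlternating.isColouring (halt : D.IsAlternating) : D.IsColouring D.overColour where
  edge := halt.overColour_edge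
  rot d := by
    by_cases hd : D.AtCrossing d
    · rw [overColour_of_atCrossing hd, overColour_of_atCrossing (D.atCrossing_rot.2 hd),
        D.isOver_rot d hd]
    -- At a vertex of degree 2, `previous d` is `edge (rot d)`: passing the vertex keeps the colour
    -- and the edge flips it.
    · have := overColour_previous hd
      rw [previous, halt.overColour_edge, opp, if_neg hd] at this
      rw [← this, Bool.not_not]
  isOver d hd := overColour_of_atCrossing hd

/-! ### Constant states and face boundaries -/

namespace IsColouring

variable {o : H → Bool} (ho : D.IsColouring o)

include ho

theorem rot_inv (d : H) : o (D.rot⁻¹ d) = !o d := by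
  rw [rot_inv_eq, ho.rot, ho.rot, ho.rot, Bool.not_not]

theorem facePerm (d : H) : o (D.facePerm d) = o d := by
  rw [VirtualLinkDiagram.facePerm, Equiv.Perm.mul_apply, ho.rot_inv, ho.edge, Bool.not_not]

theorem facePerm_pow (n : ℕ) (d : H) : o ((D.facePerm ^ n) d) = o d := by
  induction n with
  | zero => rfl
  | succ n ih => rw [pow_succ', Equiv.Perm.mul_apply, ho.facePerm, ih]

theorem sameCycle_facePerm {x y : H} (h : D.facePerm.SameCycle x y) : o y = o x := by
  obtain ⟨n, rfl⟩ := h.exists_nat_pow_eq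
  exact ho.facePerm_pow n x

theorem join_const (β : Bool) (d : H) :
    State.join (fun _ => β : D.State) d = if β = o d then D.rot⁻¹ d else D.rot d := by
  by_cases hd : D.AtCrossing d
  · rw [State.join_of_atCrossing _ hd, ho.isOver d hd]
  · rw [State.join_of_not_atCrossing _ hd]
    -- At a vertex of degree 2 both branches agree, so the formula needs no case distinction.
    have : D.rot⁻¹ d = D.rot d := by
      rw [rot_inv_eq, not_not.1 hd]
    rw [this, ite_self]

/-- Travelling along a loop of a constant state in the direction of colour `!β`, every join turns by
`rot⁻¹`, which is the rule for following a face. -/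
theorem next_const {β : Bool} {d : H} (hd : o d = !β) :
    State.next (fun _ => β : D.State) d = D.facePerm d := by
  rw [State.next_apply, ho.join_const, if_pos (by rw [ho.edge, hd, Bool.not_not])]
  rfl

theorem next_const_pow {β : Bool} {d : H} (hd : o d = !β) (n : ℕ) :
    (State.next (fun _ => β : D.State) ^ n) d = (D.facePerm ^ n) d := by
  induction n with
  | zero => rfl
  | succ n ih =>
    rw [pow_succ', pow_succ', Equiv.Perm.mul_apply, Equiv.Perm.mul_apply, ih,
      ho.next_const (by rw [ho.facePerm_pow, hd])]

theorem sameCycle_next_const {β : Bool} {d x : H} (hd : o d = !β) :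
    (State.next (fun _ => β : D.State)).SameCycle d x ↔ D.facePerm.SameCycle d x := by
  constructor
  · intro h
    obtain ⟨n, rfl⟩ := h.exists_nat_pow_eq
    rw [ho.next_const_pow hd]
    exact ⟨n, by simp⟩
  · intro h
    obtain ⟨n, rfl⟩ := h.exists_nat_pow_eq
    rw [← ho.next_const_pow hd]
    exact ⟨n, by simp⟩

/-- The loops of the state with only `β`-smoothings are the boundaries of the faces of
colour `!β`. -/
theorem loopOf_const_eq_iff {β : Bool} {d x : H} (hd : o d = !β) (hx : o x = !β) :
    State.loopOf (fun _ => β : D.State) d = State.loopOf (fun _ => β : D.State) x ↔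
      D.faceOf d = D.faceOf x := by
  rw [State.loopOf_eq_iff, ho.sameCycle_next_const hd, ho.sameCycle_next_const hd]
  have hf : D.faceOf d = D.faceOf x ↔ D.facePerm.SameCycle d x :=
    Quotient.eq (r := Equiv.Perm.SameCycle.setoid D.facePerm)
  rw [hf, or_iff_left]
  -- A face cannot contain both `d` and the reverse of `x`, since their colours differ.
  intro h
  have := ho.sameCycle_facePerm h
  rw [ho.edge, hx, hd] at this
  cases β <;> simp at this

end IsColouring

end VirtualLinkDiagram

/-! ## The states with only one type of smoothing -/

namespace VirtualLinkDiagram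

variable {H : Type*} [Fintype H] {D : VirtualLinkDiagram H} {G : Type*} [AddCommGroup G]

open Classical in
theorem State.sum_weight_edge (S : D.State) (lam : D.Component → G) (d : H) :
    ∑ x with S.next.SameCycle (D.edge d) x, D.weight lam x =
      - ∑ x with S.next.SameCycle d x, D.weight lam x := by
  rw [← Finset.sum_neg_distrib]
  refine Finset.sum_bij' (fun x _ => D.edge x) (fun x _ => D.edge x) ?_ ?_ ?_ ?_ ?_
  · intro x hx
    simp only [Finset.mem_filter, Finset.mem_univ, true_and] at hx ⊢
    rwa [← S.sameCycle_edge, D.edge_edge]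
  · intro x hx
    simp only [Finset.mem_filter, Finset.mem_univ, true_and] at hx ⊢
    rwa [S.sameCycle_edge]
  · intro x _; exact D.edge_edge x
  · intro x _; exact D.edge_edge x
  · intro x _; rw [weight_edge, neg_neg]

open Classical in
/-- The boundary of a face has label `0`. -/
theorem sum_weight_face (lam : D.Component → G) (d : H) :
    ∑ x with D.facePerm.SameCycle d x, D.weight lam x = 0 := by
  -- The darts around the face sum to the boundary of its indicator 2-chain, on which intersection
  -- numbers vanish.
  rw [← labeledIntersection_boundary lam (Pi.single (D.faceOf d) 1)]
  simp only [weight, ← map_sum]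
  congr 1
  ext y
  have hf : ∀ x, D.facePerm.SameCycle d x ↔ D.faceOf x = D.faceOf d := fun x =>
    ⟨fun h => (Quotient.sound (s := Equiv.Perm.SameCycle.setoid D.facePerm) h).symm,
      fun h => (Quotient.exact (s := Equiv.Perm.SameCycle.setoid D.facePerm) h).symm⟩
  have he : ∀ x, y = D.edge x ↔ D.edge y = x := fun x =>
    ⟨fun h => by rw [h, D.edge_edge], fun h => by rw [← h, D.edge_edge]⟩
  simp only [Finset.sum_apply, dartChain, Pi.sub_apply, Pi.single_apply, boundary,
    AddMonoidHom.coe_mk, ZeroHom.coe_mk, Finset.sum_sub_distrib, hf, he]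
  simp [Finset.sum_ite_eq]

namespace IsColouring

variable {o : H → Bool} (ho : D.IsColouring o)

include ho

/-- In the direction of colour `!β` the loop is the boundary of a face. The chosen representative
may run the other way, which only changes the sign. -/
theorem hom_loopClass_const (β : Bool) (lam : D.Component → G)
    (C : State.Loop (fun _ => β : D.State)) : D.hom lam (State.loopClass _ C) = 0 := by
  classical
  rw [State.hom_loopClass]
  generalize Quotient.out C = d
  have key : ∀ d, o d = !β →
      ∑ x with (State.next (fun _ => β : D.State)).SameCycle d x, D.weight lam x = 0 := by
    intro d hd
    simp only [ho.sameCycle_next_const hd]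
    exact sum_weight_face lam d
  by_cases hd : o d = !β
  · exact key d hd
  · have := key (D.edge d) (by rw [ho.edge, Bool.eq_not.2 hd, Bool.not_not])
    rwa [State.sum_weight_edge, neg_eq_zero] at this

theorem exists_isPotentialOn_const (β : Bool) (lam : D.Component → G) (d : H) :
    ∃ f, State.IsPotentialOn (fun _ => β : D.State) lam f
      (State.loopSet _ (State.loopOf (fun _ => β : D.State) d)) :=
  (State.hom_loopClass_eq_zero_iff _ lam _).1 (ho.hom_loopClass_const β lam _)

/-- Exactly one of the two directions of each loop has colour `!β`, and it traces one face of that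
colour. -/
theorem card_loop_const (β : Bool) :
    Fintype.card (State.Loop (fun _ => β : D.State)) =
      (Finset.univ.filter fun F : D.Face => o (Quotient.out F) = !β).card := by
  classical
  rw [← Finset.card_univ]
  symm
  refine Finset.card_bij (fun F _ => State.loopOf _ (Quotient.out F)) ?_ ?_ ?_
  · intro F _; exact Finset.mem_univ _
  · intro F hF F' hF' h
    have := (ho.loopOf_const_eq_iff (Finset.mem_filter.1 hF).2 (Finset.mem_filter.1 hF').2).1 h
    rw [← Quotient.out_eq F, ← Quotient.out_eq F']
    exact this
  · intro C _
    have key : ∀ d, o d = !β → ∃ F, ∃ hF : F ∈ Finset.univ.filter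
        fun F : D.Face => o (Quotient.out F) = !β,
        State.loopOf (fun _ => β : D.State) (Quotient.out F) = State.loopOf _ d := by
      intro d hd
      have h1 : D.faceOf (D.faceOf d).out = D.faceOf d := Quotient.out_eq _
      have h2 : D.facePerm.SameCycle (D.faceOf d).out d :=
        Quotient.exact (s := Equiv.Perm.SameCycle.setoid D.facePerm) h1
      have h3 : o (Quotient.out (D.faceOf d)) = !β := by
        rw [← ho.sameCycle_facePerm h2, hd]
      exact ⟨D.faceOf d, by simpa using h3, (ho.loopOf_const_eq_iff h3 hd).2 h1⟩
    rw [← State.loopOf_out _ C]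
    by_cases hd : o (Quotient.out C) = !β
    · exact key _ hd
    · rw [← State.loopOf_edge]
      exact key _ (by rw [ho.edge, Bool.eq_not.2 hd, Bool.not_not])

theorem i_const (β : Bool) (lam : D.Component → G) :
    State.i (fun _ => β : D.State) lam =
      (Finset.univ.filter fun F : D.Face => o (Quotient.out F) = !β).card := by
  rw [← ho.card_loop_const, ← Nat.card_eq_fintype_card, State.i]
  exact Nat.card_congr (Equiv.subtypeUnivEquiv (ho.hom_loopClass_const β lam))

theorem i_true_add_i_false (lam : D.Component → G) :
    State.i (fun _ => true : D.State) lam + State.i (fun _ => false : D.State) lam =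
      Fintype.card D.Face := by
  rw [ho.i_const, ho.i_const, add_comm, ← Finset.card_univ,
    ← Finset.card_filter_add_card_filter_not (s := Finset.univ)
      (fun F : D.Face => o (Quotient.out F) = true)]
  simp

/-- In an `h`-reduced diagram the first change of a smoothing adds no loop with label `0`. -/
theorem i_le_of_isSwitch {β : Bool} {lam : D.Component → G} (hred : D.IsHReduced lam)
    {S' : D.State} {d : H} (h : State.IsSwitch (fun _ => β : D.State) S' d) :
    S'.i lam ≤ State.i (fun _ => β : D.State) lam := by
  -- Since the constant state joins `d` to `rot d`, the dart `d` has the colour for which loops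
  -- follow faces.
  have hd : o d = !β := by
    have := h.join_eq
    rw [ho.join_const] at this
    split_ifs at this with hβ
    · rw [rot_inv_eq] at this
      exact absurd (D.rot.injective this) h.atCrossing
    · cases β <;> simpa using hβ
  have hd2 : o (D.rot (D.rot d)) = !β := by rw [ho.rot, ho.rot, hd, Bool.not_not]
  have hv2 : D.vertexOf (D.rot (D.rot d)) = D.vertexOf d :=
    (D.vertexOf_rot _).trans (D.vertexOf_rot d)
  set S : D.State := fun _ => β with hS
  obtain ⟨g1, hg1⟩ := ho.exists_isPotentialOn_const β lam d
  obtain ⟨g2, hg2⟩ := ho.exists_isPotentialOn_const β lam (D.rot (D.rot d))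
  have m1 := State.loopSet_mem_nullLoopsAt (S := S) lam (d := d) rfl hg1
  have m2 := State.loopSet_mem_nullLoopsAt (S := S) lam hv2 hg2
  rw [State.i_eq_ncard_nullLoops, State.i_eq_ncard_nullLoops,
    State.ncard_nullLoops lam S (D.vertexOf d), State.ncard_nullLoops lam S' (D.vertexOf d),
    h.nullLoopsOff_eq lam]
  refine Nat.add_le_add_left ?_ _
  rcases State.ncard_nullLoopsAt_le_one_or lam S' d with h1 | ⟨h1, hne, p1, p2⟩
  · exact h1.trans ((Set.ncard_pos (Set.toFinite _)).2 ⟨_, m1⟩)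
  rw [h1]
  obtain ⟨f, K, hf, hf', hedge, hjoin, hK⟩ := h.exists_potential lam hne p1 p2
  -- It remains to see that the constant state also has two loops here; both are then null as face
  -- boundaries. Otherwise one face has both opposite corners, and the walk between them contradicts
  -- `h`-reducedness.
  have hdiff : S.loopOf d ≠ S.loopOf (D.rot (D.rot d)) := by
    intro e
    have hF : D.facePerm.SameCycle d (D.rot (D.rot d)) :=
      Quotient.exact (s := Equiv.Perm.SameCycle.setoid D.facePerm)
        ((ho.loopOf_const_eq_iff hd hd2).1 e)
    obtain ⟨n, hn⟩ := hF.exists_nat_pow_eq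
    apply hred d n hn h.atCrossing
    rw [hom_loopClass_eq_sum_weight]
    -- The face walk follows a loop of `S`, so the potential records the accumulated weight.
    have hwalk : ∀ n : ℕ, (D.facePerm ^ n) d ∈ K ∧ f ((D.facePerm ^ n) d) =
        f d + ∑ j ∈ Finset.range n, D.weight lam ((D.facePerm ^ j) d) := by
      intro n
      induction n with
      | zero => exact ⟨hK d rfl, by simp⟩
      | succ n ih =>
        have hs : (D.facePerm ^ (n + 1)) d = S.join (D.edge ((D.facePerm ^ n) d)) := by
          rw [pow_succ', Equiv.Perm.mul_apply, ← ho.next_const (by rw [ho.facePerm_pow, hd])]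
          rfl
        have hmem := hedge _ ih.1
        rw [hs]
        refine ⟨hjoin _ hmem, ?_⟩
        rw [(hf _ hmem).1, (hf _ ih.1).2, ih.2, Finset.sum_range_succ, add_assoc]
    -- `S` joins `d` to `rot d`, and `S'` joins `rot d` to `rot (rot d)`. As a potential for both,
    -- `f` agrees at the two ends of the walk, whose label is thus `0`.
    have e1 : f (D.rot d) = f d := by rw [← h.join_eq, (hf d (hK d rfl)).1]
    have e2 : f (D.rot d) = f (D.rot (D.rot d)) := by
      have := (hf' _ (hK _ hv2)).1
      rwa [State.join_rot_rot, h.join_eq', rot_inv_eq, D.rot_four] at this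
    have := (hwalk n).2
    rw [hn, ← e2, e1] at this
    exact left_eq_add.1 this
  have hpair : ({S.loopSet (S.loopOf d), S.loopSet (S.loopOf (D.rot (D.rot d)))} :
      Set (Set H)).ncard = 2 :=
    Set.ncard_pair fun e => hdiff (S.loopSet_injective e)
  rw [← hpair]
  refine Set.ncard_le_ncard ?_ (Set.toFinite _)
  rintro B (rfl | rfl)
  · exact m1
  · exact m2

open Classical in
/-- Every other state `S` has fewer loops with label `0` than the state with only `β`-smoothings
together with the number of smoothings that are not of type `β`. -/
theorem i_lt (β : Bool) {lam : D.Component → G} (hred : D.IsHReduced lam) (S : D.State)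
    (hS : S ≠ fun _ => β) : S.i lam + 1 ≤ State.i (fun _ => β : D.State) lam +
      Fintype.card {c : D.Crossing // S c = !β} := by
  obtain ⟨n, hn⟩ : ∃ n, Fintype.card {c : D.Crossing // S c = !β} = n := ⟨_, rfl⟩
  rw [hn]
  induction n generalizing S with
  | zero =>
    refine absurd (funext fun c => ?_) hS
    by_contra hc
    exact (Fintype.card_eq_zero_iff.1 hn).false ⟨c, Bool.eq_not.2 hc⟩
  | succ n ih =>
    obtain ⟨v, hv⟩ : ∃ v, S v = !β := by
      by_contra hno
      push Not at hno
      exact hS (funext fun c => by simpa using hno c)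
    -- Undo one smoothing of the wrong type, so that `S` arises from `S1` by a single switch.
    let S1 : D.State := Function.update S v β
    have hv1 : S1 v = β := Function.update_self ..
    have hoff : ∀ c, c ≠ v → S1 c = S c := fun c hc => Function.update_of_ne hc ..
    obtain ⟨d, hd⟩ := State.exists_isSwitch (S := S1) (S' := S) v
      (by rw [hv, hv1]; simp) (fun c hc => (hoff c hc).symm)
    -- The unit gained in the inequality comes from the switch that leaves the constant state; every
    -- other switch costs at most one loop.
    by_cases h1 : S1 = fun _ => β
    · rw [h1] at hd
      have := ho.i_le_of_isSwitch hred hd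
      omega
    · have hcard : Fintype.card {c : D.Crossing // S1 c = !β} = n := by
        rw [Fintype.card_subtype] at hn ⊢
        have : (Finset.univ.filter fun c => S1 c = !β) =
            (Finset.univ.filter fun c => S c = !β).erase v := by
          ext c
          simp only [Finset.mem_filter, Finset.mem_univ, true_and, Finset.mem_erase]
          by_cases hc : c = v
          · subst hc; simp [hv1]
          · simp [hc, hoff c hc]
        rw [this, Finset.card_erase_of_mem (by simpa using hv), hn, Nat.add_sub_cancel]
      have := ih S1 h1 hcard
      have := hd.i_le lam
      omega

end IsColouring

end VirtualLinkDiagram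

/-! ## The Euler characteristic and the number of crossings -/

namespace VirtualLinkDiagram

variable {H : Type*} [Fintype H] (D : VirtualLinkDiagram H)

theorem card_eq_two_mul_card_edge : Fintype.card H = 2 * Fintype.card D.Edge := by
  classical
  let e : H → D.Edge := fun d => Quotient.mk _ d
  have he : ∀ x d, e x = e d ↔ x = d ∨ x = D.edge d := by
    intro x d
    constructor
    · intro h
      have h' : D.edge.SameCycle d x :=
        (Quotient.exact (s := Equiv.Perm.SameCycle.setoid D.edge) h).symm
      obtain ⟨n, rfl⟩ := h'.exists_nat_pow_eq
      clear h h'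
      induction n with
      | zero => exact Or.inl rfl
      | succ n ih =>
        rw [pow_succ', Equiv.Perm.mul_apply]
        rcases ih with ih | ih <;> rw [ih]
        · simp
        · simp [D.edge_edge]
    · rintro (rfl | rfl)
      · rfl
      · exact (Quotient.sound (s := Equiv.Perm.SameCycle.setoid D.edge) ⟨1, by simp⟩).symm
  rw [← Finset.card_univ, Finset.card_eq_sum_card_fiberwise (f := e) (t := Finset.univ) (by simp),
    Finset.sum_const_nat (m := 2), Finset.card_univ, mul_comm]
  intro E _
  obtain ⟨d, rfl⟩ := Quotient.exists_rep E
  have : (Finset.univ.filter fun x => e x = e d) = {d, D.edge d} := by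
    ext x; simp [he]
  exact (congrArg Finset.card this).trans (Finset.card_pair (D.edge_ne d).symm)

theorem card_fiber_vertexOf_of_atCrossing [DecidableEq D.Vertex] {d : H} (hd : D.AtCrossing d) :
    (Finset.univ.filter fun x => D.vertexOf x = D.vertexOf d).card = 4 := by
  classical
  have h : (Finset.univ.filter fun x => D.vertexOf x = D.vertexOf d) =
      {d, D.rot d, D.rot (D.rot d), D.rot (D.rot (D.rot d))} := by
    ext x
    simp only [Finset.mem_filter, Finset.mem_univ, true_and, Finset.mem_insert,
      Finset.mem_singleton]
    refine ⟨eq_of_vertexOf_eq, ?_⟩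
    rintro (rfl | rfl | rfl | rfl) <;> simp only [D.vertexOf_rot]
  have h3 : D.rot (D.rot (D.rot d)) ≠ d := by
    intro e
    have := D.rot_four d
    rw [e] at this
    exact D.rot_ne d this
  have h2 : D.rot (D.rot d) ≠ d := hd
  have h1 := D.rot_ne d
  rw [h, Finset.card_insert_of_notMem, Finset.card_insert_of_notMem, Finset.card_pair]
  · exact (D.rot_ne _).symm
  · simp only [Finset.mem_insert, Finset.mem_singleton, not_or, D.rot.injective.eq_iff]
    exact ⟨h1.symm, h2.symm⟩
  · simp only [Finset.mem_insert, Finset.mem_singleton, not_or]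
    exact ⟨h1.symm, h2.symm, h3.symm⟩

theorem card_fiber_vertexOf_of_not_atCrossing [DecidableEq D.Vertex] {d : H}
    (hd : ¬ D.AtCrossing d) :
    (Finset.univ.filter fun x => D.vertexOf x = D.vertexOf d).card = 2 := by
  classical
  have h : (Finset.univ.filter fun x => D.vertexOf x = D.vertexOf d) = {d, D.rot d} := by
    ext x
    simp only [Finset.mem_filter, Finset.mem_univ, true_and, Finset.mem_insert,
      Finset.mem_singleton]
    constructor
    · intro hx
      have := eq_of_vertexOf_eq hx
      rw [not_not.1 hd] at this
      tauto
    · rintro (rfl | rfl) <;> simp only [D.vertexOf_rot]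
  rw [h, Finset.card_pair (D.rot_ne d).symm]

/-- Handshake count: twice the number of edges is the sum of the degrees, which is 2 per vertex and
2 more per crossing. -/
theorem card_edge_eq : Fintype.card D.Edge = Fintype.card D.Vertex + D.crossingNumber := by
  classical
  have h1 : Fintype.card H = ∑ v : D.Vertex, (2 +
      if ∃ d, D.AtCrossing d ∧ D.vertexOf d = v then 2 else 0) := by
    rw [← Finset.card_univ,
      Finset.card_eq_sum_card_fiberwise (f := D.vertexOf) (t := Finset.univ) (by simp)]
    refine Finset.sum_congr rfl fun v _ => ?_
    obtain ⟨d, rfl⟩ : ∃ d, D.vertexOf d = v := Quotient.exists_rep v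
    by_cases hd : D.AtCrossing d
    · rw [if_pos ⟨d, hd, rfl⟩]
      exact D.card_fiber_vertexOf_of_atCrossing hd
    · rw [if_neg]
      · exact D.card_fiber_vertexOf_of_not_atCrossing hd
      · rintro ⟨x, hx, hv⟩
        exact hd (atCrossing_of_vertexOf_eq hv.symm hx)
  rw [Finset.sum_add_distrib, ← Finset.sum_filter] at h1
  simp only [Finset.sum_const, smul_eq_mul, Finset.card_univ] at h1
  have h2 : D.crossingNumber =
      (Finset.univ.filter fun v => ∃ d, D.AtCrossing d ∧ D.vertexOf d = v).card := by
    rw [← Fintype.card_subtype]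
    exact Fintype.card_congr (Equiv.refl _)
  have h3 := D.card_eq_two_mul_card_edge
  omega

theorem card_face_eq : (Fintype.card D.Face : ℤ) = D.crossingNumber + 2 - 2 * D.genus := by
  have h1 := D.two_mul_genus
  have h2 := D.card_edge_eq
  rw [eulerChar] at h1
  omega

end VirtualLinkDiagram

/-! ## The extreme exponents of the arrow polynomial -/

namespace LaurentPolynomial

theorem coeff_T_mul (n k : ℤ) (p : ℤ[T;T⁻¹]) : (T n * p).coeff k = p.coeff (k - n) := by
  induction p using LaurentPolynomial.induction_on' with
  | add p q hp hq =>
    rw [mul_add, AddMonoidAlgebra.coeff_add, AddMonoidAlgebra.coeff_add, Finsupp.add_apply,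
      Finsupp.add_apply, hp, hq]
  | C_mul_T m a =>
    rw [mul_left_comm, ← T_add, ← single_eq_C_mul_T, ← single_eq_C_mul_T]
    simp only [AddMonoidAlgebra.coeff_single, Finsupp.single_apply]
    congr 1
    exact propext ⟨fun h => by omega, fun h => by omega⟩

theorem coeff_neg_T_sub_T_mul (k : ℤ) (p : ℤ[T;T⁻¹]) :
    ((-T 2 - T (-2)) * p).coeff k = - p.coeff (k - 2) - p.coeff (k + 2) := by
  rw [sub_mul, neg_mul, AddMonoidAlgebra.coeff_sub, AddMonoidAlgebra.coeff_neg, Finsupp.sub_apply,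
    Finsupp.neg_apply, coeff_T_mul, coeff_T_mul, sub_neg_eq_add]

theorem coeff_neg_T_sub_T_pow_eq_zero (n : ℕ) {k : ℤ} (hk : 2 * (n : ℤ) < |k|) :
    ((-T 2 - T (-2) : ℤ[T;T⁻¹]) ^ n).coeff k = 0 := by
  induction n generalizing k with
  | zero =>
    rw [pow_zero, ← T_zero, T_apply, if_neg]
    rintro rfl
    simp at hk
  | succ n ih =>
    push_cast at hk
    rw [pow_succ', coeff_neg_T_sub_T_mul, ih, ih]
    · simp
    · rw [lt_abs] at hk ⊢; omega
    · rw [lt_abs] at hk ⊢; omega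

theorem coeff_neg_T_sub_T_pow (n : ℕ) :
    ((-T 2 - T (-2) : ℤ[T;T⁻¹]) ^ n).coeff (2 * n) = (-1) ^ n ∧
    ((-T 2 - T (-2) : ℤ[T;T⁻¹]) ^ n).coeff (-(2 * n)) = (-1) ^ n := by
  induction n with
  | zero =>
    rw [pow_zero, ← T_zero, T_apply, T_apply]
    simp
  | succ n ih =>
    -- In the recursion for an extreme coefficient, one of the two terms lies beyond the range of
    -- exponents of the `n`-th power.
    have z1 := coeff_neg_T_sub_T_pow_eq_zero n (k := 2 * n + 4) (by rw [lt_abs]; omega)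
    have z2 := coeff_neg_T_sub_T_pow_eq_zero n (k := -(2 * n) - 4) (by rw [lt_abs]; omega)
    rw [pow_succ', coeff_neg_T_sub_T_mul, coeff_neg_T_sub_T_mul]
    push_cast
    rw [show 2 * ((n : ℤ) + 1) - 2 = 2 * n by ring, show 2 * ((n : ℤ) + 1) + 2 = 2 * n + 4 by ring,
      show -(2 * ((n : ℤ) + 1)) - 2 = -(2 * n) - 4 by ring,
      show -(2 * ((n : ℤ) + 1)) + 2 = -(2 * n) by ring, ih.1, ih.2, z1, z2, pow_succ]
    simp

end LaurentPolynomial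

namespace ArrowRing

variable {G : Type*} [AddCommGroup G]

/-- The `X`-part of a state is a single monomial with coefficient `1`, so a state contributes to
only one coefficient in the `X`. -/
theorem prod_x_eq_monomial {ι : Type*} (s : Finset ι) (g : ι → G) :
    ∃ m, ∏ c ∈ s, x (g c) = (MvPolynomial.monomial m 1 : ArrowRing G) := by
  classical
  induction s using Finset.induction_on with
  | empty => exact ⟨0, rfl⟩
  | insert c s hc ih =>
    obtain ⟨m, hm⟩ := ih
    rw [Finset.prod_insert hc, hm]
    by_cases h : g c = 0
    · exact ⟨m, by rw [x_of_eq_zero h, one_mul]⟩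
    · obtain ⟨y, hy⟩ := x_of_ne_zero h
      refine ⟨Finsupp.single y 1 + m, ?_⟩
      rw [hy, MvPolynomial.X, MvPolynomial.monomial_mul, one_mul]

theorem aPow_mul_delta_pow_mul_monomial (k : ℤ) (n : ℕ) (m : NonzeroUpToSign G →₀ ℕ) :
    (aPow k * delta ^ n * MvPolynomial.monomial m 1 : ArrowRing G) =
      MvPolynomial.monomial m (LaurentPolynomial.T k *
        (-LaurentPolynomial.T 2 - LaurentPolynomial.T (-2)) ^ n) := by
  have hd : (delta : ArrowRing G) =
      MvPolynomial.C (-LaurentPolynomial.T 2 - LaurentPolynomial.T (-2)) := by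
    simp [delta, aPow]
  rw [hd, aPow, ← map_pow, ← map_mul, MvPolynomial.C_mul_monomial, mul_one]

theorem breadth_eq {p : ArrowRing G} {a b : ℤ} (ha : a ∈ p.exponents) (hb : b ∈ p.exponents)
    (h : ∀ k ∈ p.exponents, a ≤ k ∧ k ≤ b) : p.breadth = b - a := by
  have hmax : IsGreatest p.exponents b := ⟨hb, fun k hk => (h k hk).2⟩
  have hmin : IsLeast p.exponents a := ⟨ha, fun k hk => (h k hk).1⟩
  rw [breadth, maxDeg, minDeg, hmax.csSup_eq, hmin.csInf_eq]

end ArrowRing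

/-! ### Coefficients of the arrow polynomial and its breadth -/

namespace VirtualLinkDiagram

open ArrowRing

variable {H : Type*} [Fintype H] {D : VirtualLinkDiagram H} {G : Type*} [AddCommGroup G]

open Classical in
/-- The coefficient of `A ^ k` in the contribution of the state `S` to `𝒜'(L)`. -/
theorem exists_coeff_arrowPoly' (lam : D.Component → G) :
    ∃ m : D.State → NonzeroUpToSign G →₀ ℕ,
      (∀ S, (∀ C, D.hom lam (S.loopClass C) = 0) → m S = 0) ∧
      ∀ n k, (MvPolynomial.coeff n (D.arrowPoly' lam)).coeff k =
        ∑ S : D.State, if m S = n then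
          ((-LaurentPolynomial.T 2 - LaurentPolynomial.T (-2) : ℤ[T;T⁻¹]) ^ S.i lam).coeff
            (k - ((S.a : ℤ) - S.b)) else 0 := by
  choose m hm using fun S : D.State =>
    prod_x_eq_monomial Finset.univ fun C => D.hom lam (S.loopClass C)
  refine ⟨m, fun S hS => ?_, fun n k => ?_⟩
  · have h := hm S
    rw [Finset.prod_congr rfl fun C _ => x_of_eq_zero (hS C), Finset.prod_const_one] at h
    have h' : (MvPolynomial.monomial 0 1 : ArrowRing G) = MvPolynomial.monomial (m S) 1 := h
    exact ((MvPolynomial.monomial_left_inj one_ne_zero).1 h').symm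
  · have hsum : ∀ f : D.State → ℤ[T;T⁻¹], (∑ S, f S).coeff k = ∑ S, (f S).coeff k := by
      intro f
      rw [AddMonoidAlgebra.coeff_sum, Finsupp.finsetSum_apply]
    rw [arrowPoly', MvPolynomial.coeff_sum, hsum]
    refine Finset.sum_congr rfl fun S _ => ?_
    rw [hm, aPow_mul_delta_pow_mul_monomial, MvPolynomial.coeff_monomial]
    split_ifs
    · rw [LaurentPolynomial.coeff_T_mul]
    · rfl

theorem State.a_add_b (S : D.State) : S.a + S.b = D.crossingNumber := by
  classical
  rw [State.a, State.b, Fintype.card_subtype, Fintype.card_subtype, crossingNumber,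
    ← Finset.card_univ, ← Finset.card_filter_add_card_filter_not (s := Finset.univ)
      (fun c : D.Crossing => S c = true)]
  simp

end VirtualLinkDiagram

theorem mainTheorem4 {G : Type*} [AddCommGroup G] {H : Type*} [Fintype H]
    (D : VirtualLinkDiagram H) (lam : D.Component → G)
    (hconn : D.IsConnected) (halt : D.IsAlternating) (hred : D.IsHReduced lam) :
    D.arrowPoly' lam ≠ 0 ∧
      (D.arrowPoly' lam).breadth = 4 * (D.crossingNumber : ℤ) - 4 * D.genus + 4 := by
  classical
  have ho := halt.isColouring
  obtain ⟨m, hm0, hcoeff⟩ := VirtualLinkDiagram.exists_coeff_arrowPoly' (D := D) lam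
  set SA : D.State := fun _ => true with hSA
  set SB : D.State := fun _ => false with hSB
  have hab := fun S : D.State => S.a_add_b
  have hA : ∀ S : D.State, S ≠ SA → S.i lam + 1 ≤ SA.i lam + S.b := fun S hS => by
    have := ho.i_lt true hred S hS
    rw [Bool.not_true] at this
    rw [VirtualLinkDiagram.State.b]; convert this
  have hB : ∀ S : D.State, S ≠ SB → S.i lam + 1 ≤ SB.i lam + S.a := fun S hS => by
    have := ho.i_lt false hred S hS
    rw [Bool.not_false] at this
    rw [VirtualLinkDiagram.State.a]; convert this
  have hAb : SA.b = 0 := by simp [VirtualLinkDiagram.State.b, hSA]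
  have hBa : SB.a = 0 := by simp [VirtualLinkDiagram.State.a, hSB]
  have habA := hab SA
  have habB := hab SB
  -- `M` is the upper end `a - b + 2i` for the all-`A` state, `N` the lower end `a - b - 2i` for the
  -- all-`B` state.
  set M : ℤ := D.crossingNumber + 2 * SA.i lam with hM
  set N : ℤ := -(D.crossingNumber : ℤ) - 2 * SB.i lam with hN
  have top : (MvPolynomial.coeff 0 (D.arrowPoly' lam)).coeff M = (-1) ^ SA.i lam := by
    rw [hcoeff, Finset.sum_eq_single SA]
    · rw [if_pos (hm0 SA (ho.hom_loopClass_const true lam)), show M - ((SA.a : ℤ) - SA.b) =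
        2 * (SA.i lam : ℤ) by omega, (LaurentPolynomial.coeff_neg_T_sub_T_pow _).1]
    -- Since `i(S) + 1 ≤ i(SA) + b(S)` and `a + b = c`, the upper end for `S` is at most `M - 2`.
    -- Nothing can cancel the leading term.
    · intro S _ hS
      have h1 := hA S hS
      have h2 := hab S
      rw [LaurentPolynomial.coeff_neg_T_sub_T_pow_eq_zero _ (by rw [lt_abs]; omega), ite_self]
    · simp
  have bot : (MvPolynomial.coeff 0 (D.arrowPoly' lam)).coeff N = (-1) ^ SB.i lam := by
    rw [hcoeff, Finset.sum_eq_single SB]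
    · rw [if_pos (hm0 SB (ho.hom_loopClass_const false lam)), show N - ((SB.a : ℤ) - SB.b) =
        -(2 * (SB.i lam : ℤ)) by omega, (LaurentPolynomial.coeff_neg_T_sub_T_pow _).2]
    · intro S _ hS
      have h1 := hB S hS
      have h2 := hab S
      rw [LaurentPolynomial.coeff_neg_T_sub_T_pow_eq_zero _ (by rw [lt_abs]; omega), ite_self]
    · simp
  have topmem : M ∈ (D.arrowPoly' lam).exponents := ⟨0, by rw [top]; simp⟩
  have botmem : N ∈ (D.arrowPoly' lam).exponents := ⟨0, by rw [bot]; simp⟩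
  have hrange : ∀ k ∈ (D.arrowPoly' lam).exponents, N ≤ k ∧ k ≤ M := by
    rintro k ⟨n, hk⟩
    by_contra hout
    apply hk
    rw [hcoeff]
    refine Finset.sum_eq_zero fun S _ => ?_
    have h2 := hab S
    -- The weak bounds hold for all states, including the extreme ones, and confine every exponent
    -- to the interval from `N` to `M`.
    have h3 : (S.i lam : ℤ) ≤ SA.i lam + S.b := by
      by_cases hS : S = SA
      · rw [hS]; omega
      · have := hA S hS; omega
    have h4 : (S.i lam : ℤ) ≤ SB.i lam + S.a := by
      by_cases hS : S = SB
      · rw [hS]; omega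
      · have := hB S hS; omega
    rw [LaurentPolynomial.coeff_neg_T_sub_T_pow_eq_zero _ (by rw [lt_abs]; omega), ite_self]
  refine ⟨fun h0 => ?_, ?_⟩
  · rw [h0] at top
    exact pow_ne_zero (SA.i lam) (by norm_num : (-1 : ℤ) ≠ 0) top.symm
  · rw [ArrowRing.breadth_eq botmem topmem hrange]
    -- `M - N` is twice the sum of the number of crossings and the number of faces, and the Euler
    -- characteristic gives the latter.
    have hF : SA.i lam + SB.i lam = Fintype.card D.Face := ho.i_true_add_i_false lam
    have hg := D.card_face_eq
    omega

end
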